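/- Let $F$ be a field of characteristic $p>0$ with algebraic closure $\bar F$; all Lie algebras and modules over $F$ are finite-dimensional. A *saturated formation* $\mathfrak F$ of soluble Lie algebras over $F$ is an isomorphism-closed class of soluble Lie algebras over $F$ such that: quotients of algebras in $\mathfrak F$ are in $\mathfrak F$; if $A,B$ are ideals of $L$ with $L/A,\,L/B\in\mathfrak F$, then $L/(A\cap B)\in\mathfrak F$; and if $L$ is soluble with $L/\Phi(L)\in\mathfrak F$, where $\Phi(L)$ is the Frattini subalgebra (the intersection of the maximal subalgebras of $L$, which is an ideal as $L$ is soluble), then $L\in\mathfrak F$. An irreducible $S$-module $U$ is *$\mathfrak F$-central* if the split extension of $U$ by $S/C_S(U)$ is in $\mathfrak F$, where $C_S(U)=\{x\in S\mid xU=0\}$; an $S$-module is *$\mathfrak F$-hypercentral* if all its composition factors are $\mathfrak F$-central. Let $(L,[p])$ be a restricted Lie algebra over $F$. An irreducible module $M$ over $\bar F\otimes_F L$ (finite-dimensional over $\bar F$) has a *character*, the $F$-linear map $c:L\to\bar F$ with $(x^p-x^{[p]})m=c(x)^p m$ for all $x\in L$, $m\in M$. The *character cluster* $\mathrm{cl}(V)$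 of an $L$-module $V$ is the set of characters of the composition factors of the $\bar F\otimes_F L$-module $\bar F\otimes_F V$, and $\mathbb F_p\,\mathrm{cl}(V)$ is the set of $\mathbb F_p$-linear combinations of elements of $\mathrm{cl}(V)$ (the empty combination $0$ included). **Theorem.** Let $\mathfrak F$ be a saturated formation of soluble Lie algebras over $F$, and let $(L,[p])$ be a restricted Lie algebra over $F$ with $z^{[p]}=0$ for all $z$ in the centre of $L$. Let $S\neq 0$ be a subnormal subalgebra of $L$ with $S\in\mathfrak F$ (subnormal: there is a chain $S=S_0\subseteq S_1\subseteq\dots\subseteq S_n=L$ of subalgebras with each $S_i$ an ideal of $S_{i+1}$). Let $V,W$ be $L$-modules with $\mathrm{cl}(W)\subseteq\mathbb F_p\,\mathrm{cl}(V)$, and suppose that $V$, regarded as an $S$-module, is $\mathfrak F$-hypercentral. Then $W$, regarded as an $S$-module, is $\mathfrak F$-hypercentral. -/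

import Mathlib

open scoped TensorProduct

universe u

noncomputable section

attribute [local instance 100] LieRing.ofAssociativeRing

/-! ### Split extensions -/

/-- The vector space `V × Q` underlying the split extension of the `F`-module `V` by the Lie algebra
`Q`, which acts on `V` through the representation `φ`. -/
@[ext] structure SplitExt {F : Type*} [CommRing F] {Q : Type*} [LieRing Q] [LieAlgebra F Q]
    {V : Type*} [AddCommGroup V] [Module F V] (φ : Q →ₗ⁅F⁆ Module.End F V) where
  /-- the component in the abelian ideal `V` -/
  vec : V
  /-- the component in the complement `Q` -/
  alg : Q

namespace SplitExt

variable {F : Type*} [CommRing F] {Q : Type*} [LieRing Q] [LieAlgebra F Q]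
  {V : Type*} [AddCommGroup V] [Module F V] (φ : Q →ₗ⁅F⁆ Module.End F V)

/-- As a type, a split extension is a product. -/
def toProd : SplitExt φ ≃ V × Q where
  toFun a := (a.vec, a.alg)
  invFun a := ⟨a.1, a.2⟩
  left_inv _ := rfl
  right_inv _ := rfl

instance : AddCommGroup (SplitExt φ) := (toProd φ).addCommGroup

instance : Module F (SplitExt φ) := (toProd φ).module F

/-- `[(v, a), (w, b)] = (a w - b v, [a, b])`; in particular `V` is an abelian ideal. -/
instance : Bracket (SplitExt φ) (SplitExt φ) :=
  ⟨fun s t => ⟨φ s.alg t.vec - φ t.alg s.vec, ⁅s.alg, t.alg⁆⟩⟩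

@[simp] theorem vec_add (s t : SplitExt φ) : (s + t).vec = s.vec + t.vec := rfl
@[simp] theorem alg_add (s t : SplitExt φ) : (s + t).alg = s.alg + t.alg := rfl
@[simp] theorem vec_zero : (0 : SplitExt φ).vec = 0 := rfl
@[simp] theorem alg_zero : (0 : SplitExt φ).alg = 0 := rfl
@[simp] theorem vec_smul (c : F) (s : SplitExt φ) : (c • s).vec = c • s.vec := rfl
@[simp] theorem alg_smul (c : F) (s : SplitExt φ) : (c • s).alg = c • s.alg := rfl
@[simp] theorem vec_lie (s t : SplitExt φ) :
    ⁅s, t⁆.vec = φ s.alg t.vec - φ t.alg s.vec := rfl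
@[simp] theorem alg_lie (s t : SplitExt φ) : ⁅s, t⁆.alg = ⁅s.alg, t.alg⁆ := rfl

instance : LieRing (SplitExt φ) where
  add_lie s t r := by ext <;> (simp; try abel)
  lie_add s t r := by ext <;> (simp; try abel)
  lie_self s := by ext <;> simp
  leibniz_lie s t r := by
    ext
    · simp [LieHom.map_lie, Ring.lie_def]; abel
    · simp

instance : LieAlgebra F (SplitExt φ) where
  lie_smul c s t := by ext <;> simp [smul_sub]

end SplitExt

/-! ### Classes of Lie algebras -/

/-- A class of Lie algebras over `F`. -/
abbrev LieAlgClass (F : Type u) [Field F] : Type (u + 1) :=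
  ∀ (L : Type u) [LieRing L] [LieAlgebra F L], Prop

/-- The Frattini subalgebra `Φ(L)`: the intersection of the maximal subalgebras of `L`. -/
def frattiniSubalgebra (F L : Type*) [Field F] [LieRing L] [LieAlgebra F L] : LieSubalgebra F L :=
  Order.radical (LieSubalgebra F L)

/-- `𝔉` is a saturated formation of (finite-dimensional) soluble Lie algebras over `F`. -/
structure IsSaturatedFormation {F : Type u} [Field F] (𝔉 : LieAlgClass F) : Prop where
  finite : ∀ (L : Type u) [LieRing L] [LieAlgebra F L], 𝔉 L → FiniteDimensional F L
  soluble : ∀ (L : Type u) [LieRing L] [LieAlgebra F L], 𝔉 L → LieAlgebra.IsSolvable L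
  iso : ∀ (L M : Type u) [LieRing L] [LieAlgebra F L] [LieRing M] [LieAlgebra F M],
    (L ≃ₗ⁅F⁆ M) → 𝔉 L → 𝔉 M
  quotient : ∀ (L : Type u) [LieRing L] [LieAlgebra F L] (A : LieIdeal F L), 𝔉 L → 𝔉 (L ⧸ A)
  subdirect : ∀ (L : Type u) [LieRing L] [LieAlgebra F L] [FiniteDimensional F L]
    (A B : LieIdeal F L), 𝔉 (L ⧸ A) → 𝔉 (L ⧸ B) → 𝔉 (L ⧸ (A ⊓ B))
  /-- For soluble `L` the Frattini subalgebra is an ideal, and, `𝔉` being closed under quotients,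
  this says that `L / Φ(L) ∈ 𝔉` implies `L ∈ 𝔉`. -/
  saturated : ∀ (L : Type u) [LieRing L] [LieAlgebra F L] [FiniteDimensional F L]
    [LieAlgebra.IsSolvable L] (A : LieIdeal F L),
    (A : Set L) ⊆ frattiniSubalgebra F L → 𝔉 (L ⧸ A) → 𝔉 L

/-! ### Modules -/

/-- The factor `N₂ / N₁` of a module, for submodules `N₁ ≤ N₂`. -/
abbrev moduleFactor {F L V : Type*} [CommRing F] [LieRing L] [LieAlgebra F L] [AddCommGroup V]
    [Module F V] [LieRingModule L V] [LieModule F L V] (N₁ N₂ : LieSubmodule F L V) : Type _ :=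
  N₂ ⧸ N₁.comap N₂.incl

/-- The faithful representation of `L / C_L(V)` on `V`, where `C_L(V) = {x | x V = 0}`. -/
def quotientRep (F L V : Type*) [Field F] [LieRing L] [LieAlgebra F L] [AddCommGroup V]
    [Module F V] [LieRingModule L V] [LieModule F L V] :
    (L ⧸ (LieModule.toEnd F L V).ker) →ₗ⁅F⁆ Module.End F V :=
  (LieModule.toEnd F L V).range.incl.comp
    ((LieModule.toEnd F L V).quotKerEquivRange : _ →ₗ⁅F⁆ (LieModule.toEnd F L V).range)

/-- An `L`-module `V` is `𝔉`-central if it is irreducible and the split extension of `V` by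
`L / C_L(V)` is in `𝔉`. -/
def IsFCentral {F : Type u} [Field F] (𝔉 : LieAlgClass F) (L V : Type u) [LieRing L]
    [LieAlgebra F L] [AddCommGroup V] [Module F V] [LieRingModule L V] [LieModule F L V] : Prop :=
  LieModule.IsIrreducible F L V ∧ 𝔉 (SplitExt (quotientRep F L V))

/-- An `L`-module is `𝔉`-hypercentral if all its composition factors are `𝔉`-central. -/
def IsFHypercentral {F : Type u} [Field F] (𝔉 : LieAlgClass F) (L V : Type u) [LieRing L]
    [LieAlgebra F L] [AddCommGroup V] [Module F V] [LieRingModule L V] [LieModule F L V] : Prop :=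
  ∀ N₁ N₂ : LieSubmodule F L V, N₁ ≤ N₂ → LieModule.IsIrreducible F L (moduleFactor N₁ N₂) →
    IsFCentral 𝔉 L (moduleFactor N₁ N₂)

/-! ### Subnormal subalgebras -/

/-- `H` is a subnormal subalgebra: there is a chain `H = H₀ ≤ H₁ ≤ ⋯ ≤ Hₙ = L` in which each term
is an ideal of the next one. -/
inductive IsSubnormalSubalgebra {F L : Type*} [CommRing F] [LieRing L] [LieAlgebra F L] :
    LieSubalgebra F L → Prop
  | top : IsSubnormalSubalgebra ⊤
  | step (H K : LieSubalgebra F L) (hle : H ≤ K) (hideal : ∀ x ∈ K, ∀ y ∈ H, ⁅x, y⁆ ∈ H)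
      (hK : IsSubnormalSubalgebra K) : IsSubnormalSubalgebra H

/-! ### Restricted Lie algebras and characters -/

/-- `jacobsonCoeff x y n k` is the coefficient of `T ^ k` in `(ad (T x + y)) ^ n (x) ∈ L[T]`. -/
def jacobsonCoeff {L : Type*} [LieRing L] (x y : L) : ℕ → ℕ → L
  | 0, 0 => x
  | 0, _ + 1 => 0
  | n + 1, 0 => ⁅y, jacobsonCoeff x y n 0⁆
  | n + 1, k + 1 => ⁅x, jacobsonCoeff x y n k⁆ + ⁅y, jacobsonCoeff x y n (k + 1)⁆

/-- `pow : x ↦ x^{[p]}` is a `p`-operation on `L`, that is, `(L, pow)` is a restricted Lie algebra.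
In the last axiom, the term with index `i` is Jacobson's `s_{i+1}(x, y)`, where
`(ad (T x + y)) ^ (p - 1) (x) = ∑ j s_j(x, y) T ^ (j - 1)`, the sum being over `1 ≤ j ≤ p - 1`. -/
structure IsPOperation (F : Type*) {L : Type*} [Field F] [LieRing L] [LieAlgebra F L] (p : ℕ)
    (pow : L → L) : Prop where
  ad_pow : ∀ x : L, LieAlgebra.ad F L (pow x) = LieAlgebra.ad F L x ^ p
  smul_pow : ∀ (a : F) (x : L), pow (a • x) = a ^ p • pow x
  add_pow : ∀ x y : L, pow (x + y) = pow x + pow y +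
    ∑ i ∈ Finset.range (p - 1), ((i + 1 : ℕ) : F)⁻¹ • jacobsonCoeff x y (p - 1) i

/-- For a field extension `K` of `F`, the `K ⊗ L`-module `M` has character `c` if
`(x ^ p - x^{[p]}) m = c(x) ^ p m` for all `x ∈ L` and `m ∈ M`. (A `K`-linear form on `K ⊗ L` is
given by its restriction to `L`, an `F`-linear map `L → K`.) -/
def HasCharacter {F K L : Type*} (M : Type*) [Field F] [Field K] [Algebra F K] [LieRing L]
    [LieAlgebra F L] [AddCommGroup M] [Module K M] [LieRingModule (K ⊗[F] L) M]
    [LieModule K (K ⊗[F] L) M] (p : ℕ) (pow : L → L) (c : L →ₗ[F] K) : Prop :=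
  ∀ (x : L) (m : M),
    (LieModule.toEnd K (K ⊗[F] L) M (1 ⊗ₜ[F] x) ^ p) m - ⁅(1 : K) ⊗ₜ[F] pow x, m⁆ = c x ^ p • m

/-- The character cluster `cl(V)`: the set of the characters of the composition factors of
`F̄ ⊗ V`, where `F̄` is the algebraic closure of `F`. -/
def characterCluster (F : Type*) {L : Type*} (V : Type*) [Field F] [LieRing L] [LieAlgebra F L]
    [AddCommGroup V] [Module F V] [LieRingModule L V] [LieModule F L V] (p : ℕ) (pow : L → L) :
    Set (L →ₗ[F] AlgebraicClosure F) :=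
  {c | ∃ N₁ N₂ : LieSubmodule (AlgebraicClosure F) (AlgebraicClosure F ⊗[F] L)
        (AlgebraicClosure F ⊗[F] V), N₁ ≤ N₂ ∧
      LieModule.IsIrreducible (AlgebraicClosure F) (AlgebraicClosure F ⊗[F] L)
        (moduleFactor N₁ N₂) ∧
      HasCharacter (moduleFactor N₁ N₂) p pow c}

/-- The set of `𝔽_p`-linear combinations of elements of `X`, where `F` has characteristic `p`. -/
def primeFieldSpan (F : Type*) (p : ℕ) {E : Type*} [Field F] [AddCommGroup E] [Module F E]
    (X : Set E) : Set E :=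
  {c | ∃ a : E →₀ ZMod p, (a.support : Set E) ⊆ X ∧ c = a.sum fun d r => (r.cast : F) • d}

end

/-!
# Character clusters and `𝔉`-hypercentral modules

For `S ∈ 𝔉`, an `S`-module is `𝔉`-hypercentral exactly when its split extension by `S` lies in `𝔉`
(`splitExt_of_isFHypercentral`, `isFHypercentral_of_splitExt`). In this form the class of
hypercentral modules is seen to be closed under subquotients, extensions
(`splitExt_of_extension`: an irreducible submodule either lies in the Frattini subalgebra of the
split extension or is complemented) and tensor products (`splitExt_tensorRep`: for hypercentral `V`
and `W`, the subspace `V ⊗ W` lies in the Frattini subalgebra of the split extension by `S` of the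
nilpotent Lie algebra `V × W × (V ⊗ W)`, since the bracket of `V` with `W` is all of `V ⊗ W`).
It contains the trivial modules and, `S` being subnormal, the adjoint module `L`.

Let `𝒞` be the class of the `L`-modules that are hypercentral over `S`, and `U` the enveloping
algebra of `L`. A finite-dimensional module annihilated by `Ann_U(Y)` for some `Y` in `𝒞` is a
subquotient of a power of `Y`, so it belongs to `𝒞`. Thus it suffices to control annihilators,
and this makes sense for modules over extension fields: they are called dominated when they are
annihilated by such an `Ann_U(Y)`. Tensor products of dominated modules are dominated, by means of
the comultiplication of `U`. Three steps lead from `V` to `W`.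

* Every restricted module on which the centre of `L` acts trivially is dominated
  (`dominated_of_isCentralRestricted`). Indeed `L` modulo its centre acts faithfully on the adjoint
  module. If `e` is a basis of a complement of the centre, the restricted words in `e` are
  linearly independent on a finite sum of tensor products of trivial and adjoint modules, because
  contracting with matrix coefficients of the adjoint module acts on words to leading order as
  partial derivatives do, and factorials of numbers less than `p` are invertible. The same
  restricted words span the image of `U` in any restricted representation that is trivial on the
  centre.

* Let `K` be the algebraic closure of `F`. The characters of dominated modules over `K` are closed
  under addition, by tensor products, so every element of `𝔽_p cl(V)` is one. If `M` is irreducible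
  and has the same character as a dominated module `N ≠ 0`, then `Hom_K(N, M)` has character zero.
  On a minimal submodule `E` of it a central element `z` acts nilpotently, as `z^{[p]} = 0`, hence
  trivially; so `E` is dominated by the first step, and so is `M`, an image of `E ⊗ N`
  (`dominated_of_irreducible`). By Jacobson's formula and Schur's lemma every irreducible module
  over `K ⊗ L` has a character (`exists_repHasCharacter`). So all the composition factors of
  `K ⊗ W` are dominated.

* Let `W₁` be a maximal submodule of `W` among those in `𝒞`. If `W₁ ≠ W`, some irreducible factor
  `N₂ / (K ⊗ W₁)` is annihilated by `Ann_U(Y)` with `Y` in `𝒞`. Coordinates with respect to a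
  basis of `K` over `F` of an element of `N₂` yield some `w ∉ W₁` with `Ann_U(Y) w ⊆ W₁`, and the
  submodule of all such `w` contradicts the maximality of `W₁` (`splitExtClass_of_forall_factor`).
-/

noncomputable section

attribute [local instance 100] LieRing.ofAssociativeRing

/-! ### Membership in a saturated formation -/

/-- The first isomorphism theorem for a surjective morphism of Lie algebras. -/
def LieHom.quotKerEquivOfSurjective {F X Y : Type*} [CommRing F] [LieRing X] [LieAlgebra F X]
    [LieRing Y] [LieAlgebra F Y] (f : X →ₗ⁅F⁆ Y) (hf : Function.Surjective f) :
    (X ⧸ f.ker) ≃ₗ⁅F⁆ Y :=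
  f.quotKerEquivRange.trans
    (LieEquiv.ofBijective f.range.incl
      ⟨Subtype.val_injective, fun y => ⟨⟨y, hf y⟩, rfl⟩⟩)

namespace IsSaturatedFormation

variable {F : Type u} [Field F] {𝔉 : LieAlgClass F} (h𝔉 : IsSaturatedFormation 𝔉)
  {X Y Y' : Type u} [LieRing X] [LieAlgebra F X] [LieRing Y] [LieAlgebra F Y]
  [LieRing Y'] [LieAlgebra F Y']

include h𝔉

theorem of_surjective (f : X →ₗ⁅F⁆ Y) (hf : Function.Surjective f) (hX : 𝔉 X) : 𝔉 Y :=
  h𝔉.iso _ _ (f.quotKerEquivOfSurjective hf) (h𝔉.quotient X f.ker hX)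

theorem of_subdirect [FiniteDimensional F X] (f : X →ₗ⁅F⁆ Y) (hf : Function.Surjective f)
    (g : X →ₗ⁅F⁆ Y') (hg : Function.Surjective g) (hfg : ∀ x, f x = 0 → g x = 0 → x = 0)
    (hY : 𝔉 Y) (hY' : 𝔉 Y') : 𝔉 X := by
  have h := h𝔉.subdirect X f.ker g.ker (h𝔉.iso _ _ (f.quotKerEquivOfSurjective hf).symm hY)
    (h𝔉.iso _ _ (g.quotKerEquivOfSurjective hg).symm hY')
  have hk : f.ker ⊓ g.ker = (LieHom.id : X →ₗ⁅F⁆ X).ker := by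
    ext x
    simp only [LieSubmodule.mem_inf, LieHom.mem_ker, LieHom.id_apply]
    exact ⟨fun hx => hfg x hx.1 hx.2, fun hx => by simp [hx]⟩
  rw [hk] at h
  exact h𝔉.iso _ _ ((LieHom.id : X →ₗ⁅F⁆ X).quotKerEquivOfSurjective Function.surjective_id) h

end IsSaturatedFormation

/-- An extension of a soluble Lie algebra by an abelian ideal is soluble. -/
theorem isSolvable_of_ker_abelian {F X Y : Type*} [Field F] [LieRing X] [LieAlgebra F X]
    [LieRing Y] [LieAlgebra F Y] (f : X →ₗ⁅F⁆ Y) [LieAlgebra.IsSolvable Y]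
    (hab : ∀ a b, f a = 0 → f b = 0 → ⁅a, b⁆ = 0) : LieAlgebra.IsSolvable X := by
  obtain ⟨k, hk⟩ := LieAlgebra.IsSolvable.solvable (R := F) (L := Y)
  refine LieAlgebra.IsSolvable.mk (R := F) (k := k + 1) ?_
  have hle := LieIdeal.derivedSeries_map_le (f := f) k
  rw [hk, le_bot_iff, LieIdeal.map_eq_bot_iff] at hle
  rw [LieAlgebra.derivedSeries_def, LieAlgebra.derivedSeriesOfIdeal_succ,
    LieSubmodule.lie_eq_bot_iff]
  intro a ha b hb
  exact hab a b (f.mem_ker.1 (hle ha)) (f.mem_ker.1 (hle hb))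

namespace IsSaturatedFormation

variable {F : Type u} [Field F] {𝔉 : LieAlgClass F} (h𝔉 : IsSaturatedFormation 𝔉)
  {X Y : Type u} [LieRing X] [LieAlgebra F X] [LieRing Y] [LieAlgebra F Y]

include h𝔉

theorem of_ker_le_frattini [FiniteDimensional F X] (f : X →ₗ⁅F⁆ Y) (hf : Function.Surjective f)
    (hab : ∀ a b, f a = 0 → f b = 0 → ⁅a, b⁆ = 0)
    (hker : ∀ (M : LieSubalgebra F X), IsCoatom M → ∀ a, f a = 0 → a ∈ M) (hY : 𝔉 Y) : 𝔉 X := by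
  have := h𝔉.soluble Y hY
  have := isSolvable_of_ker_abelian f hab
  refine h𝔉.saturated X f.ker ?_ (h𝔉.iso _ _ (f.quotKerEquivOfSurjective hf).symm hY)
  intro a ha
  have : LieSubalgebra.lieSpan F X {a} ≤ frattiniSubalgebra F X :=
    le_iInf₂ fun M hM => LieSubalgebra.lieSpan_le.2 (by
      simpa using hker M hM a (f.mem_ker.1 ha))
  exact this (LieSubalgebra.subset_lieSpan rfl)

end IsSaturatedFormation

/-- A maximal subalgebra that does not contain an ideal is supplemented by it. -/
theorem LieSubalgebra.exists_add_of_isCoatom {F X Y : Type*} [Field F] [LieRing X] [LieAlgebra F X]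
    [LieRing Y] [LieAlgebra F Y] (f : X →ₗ⁅F⁆ Y) {M : LieSubalgebra F X} (hM : IsCoatom M)
    {x₀ : X} (hx₀ : f x₀ = 0) (hx₀M : x₀ ∉ M) (x : X) : ∃ m ∈ M, ∃ k, f k = 0 ∧ x = m + k := by
  let M' : LieSubalgebra F X :=
    { M.toSubmodule ⊔ f.ker.toSubmodule with
      lie_mem' := by
        intro x y hx hy
        change x ∈ M.toSubmodule ⊔ f.ker.toSubmodule at hx
        change y ∈ M.toSubmodule ⊔ f.ker.toSubmodule at hy
        change ⁅x, y⁆ ∈ M.toSubmodule ⊔ f.ker.toSubmodule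
        obtain ⟨m, hm, k, hk, rfl⟩ := Submodule.mem_sup.1 hx
        obtain ⟨n, hn, l, hl, rfl⟩ := Submodule.mem_sup.1 hy
        have hk' : f k = 0 := f.mem_ker.1 hk
        have hl' : f l = 0 := f.mem_ker.1 hl
        rw [lie_add, add_lie, add_assoc]
        refine add_mem (Submodule.mem_sup_left (M.lie_mem hm hn)) (Submodule.mem_sup_right ?_)
        exact f.mem_ker.2 (by simp [hk', hl']) }
  have hlt : M < M' := by
    refine lt_of_le_of_ne (fun x hx => ?_) fun h => hx₀M ?_
    · exact (Submodule.mem_sup_left hx : x ∈ M.toSubmodule ⊔ f.ker.toSubmodule)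
    · rw [h]
      exact (Submodule.mem_sup_right (f.mem_ker.2 hx₀) :
        x₀ ∈ M.toSubmodule ⊔ f.ker.toSubmodule)
  have hx : x ∈ M' := by rw [hM.2 M' hlt]; trivial
  obtain ⟨m, hm, k, hk, rfl⟩ :=
    Submodule.mem_sup.1 (show x ∈ M.toSubmodule ⊔ f.ker.toSubmodule from hx)
  exact ⟨m, hm, k, f.mem_ker.1 hk, rfl⟩

namespace SplitExt

variable {F Q Q' V V' X : Type*} [CommRing F] [LieRing Q] [LieAlgebra F Q] [LieRing Q']
  [LieAlgebra F Q'] [AddCommGroup V] [Module F V] [AddCommGroup V'] [Module F V'] [LieRing X]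
  [LieAlgebra F X]

/-- The linear equivalence of a split extension with the product. -/
def linearEquiv (φ : Q →ₗ⁅F⁆ Module.End F V) : SplitExt φ ≃ₗ[F] V × Q :=
  { toProd φ with
    map_add' := fun _ _ => rfl
    map_smul' := fun _ _ => rfl }

instance [Module.Finite F V] [Module.Finite F Q] (φ : Q →ₗ⁅F⁆ Module.End F V) :
    Module.Finite F (SplitExt φ) :=
  Module.Finite.equiv (linearEquiv φ).symm

theorem finite_vec {F Q V : Type*} [Field F] [LieRing Q] [LieAlgebra F Q] [AddCommGroup V]
    [Module F V] (φ : Q →ₗ⁅F⁆ Module.End F V) [Module.Finite F (SplitExt φ)] :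
    Module.Finite F V :=
  Module.Finite.of_surjective ((LinearMap.fst F V Q).comp (linearEquiv φ).toLinearMap)
    fun v => ⟨⟨v, 0⟩, rfl⟩

/-- The morphism `(v, q) ↦ f v + g q` out of a split extension. -/
def desc (φ : Q →ₗ⁅F⁆ Module.End F V) (f : V →ₗ[F] X) (g : Q →ₗ⁅F⁆ X)
    (hfg : ∀ q v, f (φ q v) = ⁅g q, f v⁆) (hf : ∀ v w, ⁅f v, f w⁆ = 0) : SplitExt φ →ₗ⁅F⁆ X where
  toFun a := f a.vec + g a.alg
  map_add' a b := by simp; abel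
  map_smul' c a := by simp
  map_lie' {a b} := by
    simp only [vec_lie, alg_lie, map_sub, hfg, LieHom.map_lie, lie_add, add_lie, hf]
    rw [← lie_skew (f a.vec) (g b.alg)]
    abel

@[simp] theorem desc_apply (φ : Q →ₗ⁅F⁆ Module.End F V) (f : V →ₗ[F] X) (g : Q →ₗ⁅F⁆ X)
    (hfg hf) (a : SplitExt φ) : desc φ f g hfg hf a = f a.vec + g a.alg := rfl

/-- The morphism of split extensions given by an equivariant map. -/
def map (φ : Q →ₗ⁅F⁆ Module.End F V) (ψ : Q' →ₗ⁅F⁆ Module.End F V') (f : V →ₗ[F] V')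
    (g : Q →ₗ⁅F⁆ Q') (hfg : ∀ q v, f (φ q v) = ψ (g q) (f v)) : SplitExt φ →ₗ⁅F⁆ SplitExt ψ where
  toFun a := ⟨f a.vec, g a.alg⟩
  map_add' a b := by ext <;> simp
  map_smul' c a := by ext <;> simp
  map_lie' {a b} := by ext <;> simp [hfg]

@[simp] theorem map_vec (φ : Q →ₗ⁅F⁆ Module.End F V) (ψ : Q' →ₗ⁅F⁆ Module.End F V')
    (f : V →ₗ[F] V') (g : Q →ₗ⁅F⁆ Q') (hfg) (a : SplitExt φ) :
    (map φ ψ f g hfg a).vec = f a.vec := rfl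

@[simp] theorem map_alg (φ : Q →ₗ⁅F⁆ Module.End F V) (ψ : Q' →ₗ⁅F⁆ Module.End F V')
    (f : V →ₗ[F] V') (g : Q →ₗ⁅F⁆ Q') (hfg) (a : SplitExt φ) :
    (map φ ψ f g hfg a).alg = g a.alg := rfl

theorem map_surjective (φ : Q →ₗ⁅F⁆ Module.End F V) (ψ : Q' →ₗ⁅F⁆ Module.End F V')
    {f : V →ₗ[F] V'} {g : Q →ₗ⁅F⁆ Q'} (hfg) (hf : Function.Surjective f)
    (hg : Function.Surjective g) : Function.Surjective (map φ ψ f g hfg) := by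
  rintro ⟨v, q⟩
  obtain ⟨v, rfl⟩ := hf v
  obtain ⟨q, rfl⟩ := hg q
  exact ⟨⟨v, q⟩, rfl⟩

/-- The projection of a split extension to its complement. -/
def proj (φ : Q →ₗ⁅F⁆ Module.End F V) : SplitExt φ →ₗ⁅F⁆ Q where
  toFun a := a.alg
  map_add' _ _ := rfl
  map_smul' _ _ := rfl
  map_lie' := rfl

@[simp] theorem proj_apply (φ : Q →ₗ⁅F⁆ Module.End F V) (a : SplitExt φ) :
    proj φ a = a.alg := rfl

theorem proj_surjective (φ : Q →ₗ⁅F⁆ Module.End F V) : Function.Surjective (proj φ) :=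
  fun q => ⟨⟨0, q⟩, rfl⟩

end SplitExt

/-! ### Modules whose split extension lies in the formation -/

section SubQuotRep

variable {F S V : Type*} [CommRing F] [LieRing S] [LieAlgebra F S] [AddCommGroup V] [Module F V]
  (φ : S →ₗ⁅F⁆ Module.End F V) (A : Submodule F V) (hA : ∀ s, ∀ x ∈ A, φ s x ∈ A)

/-- The restriction of a representation to an invariant subspace. -/
def subRep : S →ₗ⁅F⁆ Module.End F A where
  toFun s := (φ s).restrict (hA s)
  map_add' a b := by ext; simp
  map_smul' c a := by ext; simp
  map_lie' {a b} := by ext; simp [Ring.lie_def]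

/-- The representation on the quotient by an invariant subspace. -/
def quotRep : S →ₗ⁅F⁆ Module.End F (V ⧸ A) where
  toFun s := A.mapQ A (φ s) (hA s)
  map_add' a b := by ext; simp
  map_smul' c a := by ext; simp
  map_lie' {a b} := by ext; simp [Ring.lie_def]

end SubQuotRep

namespace IsSaturatedFormation

variable {F : Type u} [Field F] {𝔉 : LieAlgClass F} (h𝔉 : IsSaturatedFormation 𝔉)
include h𝔉

/-- Two copies of the ideal, the obvious one and the antidiagonal one, have
trivial intersection in the split extension, and both quotients are the given algebra. -/
theorem splitExt_of_abelian_ideal {E A : Type u} [LieRing E] [LieAlgebra F E] [AddCommGroup A]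
    [Module F A] (φ : E →ₗ⁅F⁆ Module.End F A) (j : A →ₗ[F] E) (hj : Function.Injective j)
    (hφ : ∀ e a, j (φ e a) = ⁅e, j a⁆) (hab : ∀ a b, ⁅j a, j b⁆ = 0) (hE : 𝔉 E) :
    𝔉 (SplitExt φ) := by
  have := h𝔉.finite E hE
  have : FiniteDimensional F A := FiniteDimensional.of_injective j hj
  refine h𝔉.of_subdirect (SplitExt.proj φ) (SplitExt.proj_surjective φ)
    (SplitExt.desc φ j LieHom.id (fun e a => by rw [LieHom.id_apply, hφ]) hab)
    (fun e => ⟨⟨0, e⟩, by simp⟩) ?_ hE hE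
  rintro ⟨a, e⟩ h1 h2
  simp only [SplitExt.proj_apply] at h1
  subst h1
  simp only [SplitExt.desc_apply, map_zero, add_zero] at h2
  have : a = 0 := hj (by rw [h2, map_zero])
  subst this
  rfl

variable {S : Type u} [LieRing S] [LieAlgebra F S]

/-- Passing to a subquotient `Q` of a module `X`, presented by equivariant maps `Θ : R → X`
and `ψ : R → Q` with `ker Θ ≤ ker ψ`; the auxiliary module `R` may be infinite-dimensional. -/
theorem splitExt_of_subquotient {X R Q : Type u} [AddCommGroup X] [Module F X] [AddCommGroup R]
    [Module F R] [AddCommGroup Q] [Module F Q] (φ : S →ₗ⁅F⁆ Module.End F X)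
    (ρ : S →ₗ⁅F⁆ Module.End F R) (χ : S →ₗ⁅F⁆ Module.End F Q) (Θ : R →ₗ[F] X) (ψ : R →ₗ[F] Q)
    (hΘ : ∀ s r, Θ (ρ s r) = φ s (Θ r)) (hψ : ∀ s r, ψ (ρ s r) = χ s (ψ r))
    (hsurj : Function.Surjective ψ) (hker : LinearMap.ker Θ ≤ LinearMap.ker ψ)
    (hX : 𝔉 (SplitExt φ)) : 𝔉 (SplitExt χ) := by
  let A := LinearMap.range Θ
  have hA : ∀ s, ∀ x ∈ A, φ s x ∈ A := by
    rintro s _ ⟨r, rfl⟩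
    exact ⟨ρ s r, hΘ s r⟩
  let φA : SplitExt φ →ₗ⁅F⁆ Module.End F A := subRep (φ.comp (SplitExt.proj φ)) A fun e => hA e.alg
  have h1 : 𝔉 (SplitExt φA) := h𝔉.splitExt_of_abelian_ideal φA
    { toFun := fun a => ⟨a, 0⟩
      map_add' := fun a b => by ext <;> simp
      map_smul' := fun c a => by ext <;> simp }
    (fun a b hab => Subtype.ext (congrArg SplitExt.vec hab))
    (fun e a => SplitExt.ext (by simp; rfl) (by simp)) (fun a b => by ext <;> simp) hX
  -- the quotient map `A → Q` induced by `ψ`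
  let π : A →ₗ[F] Q := (LinearMap.ker Θ).liftQ ψ hker ∘ₗ Θ.quotKerEquivRange.symm.toLinearMap
  have hπ : ∀ r, π ⟨Θ r, r, rfl⟩ = ψ r := fun r => by
    have : Θ.quotKerEquivRange.symm ⟨Θ r, r, rfl⟩ = (LinearMap.ker Θ).mkQ r := by
      rw [LinearEquiv.symm_apply_eq]; rfl
    simp [π, this]
  refine h𝔉.of_surjective (SplitExt.map φA χ π (SplitExt.proj φ) ?_)
    (SplitExt.map_surjective _ _ _ ?_ (SplitExt.proj_surjective φ)) h1
  · rintro e ⟨_, r, rfl⟩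
    have : φA e ⟨Θ r, r, rfl⟩ = ⟨Θ (ρ e.alg r), _, rfl⟩ := Subtype.ext (hΘ _ _).symm
    rw [this, hπ, hπ, hψ]; rfl
  · intro q
    obtain ⟨r, rfl⟩ := hsurj q
    exact ⟨_, hπ r⟩

theorem splitExt_of_injective {X R : Type u} [AddCommGroup X] [Module F X] [AddCommGroup R]
    [Module F R] (φ : S →ₗ⁅F⁆ Module.End F X) (ρ : S →ₗ⁅F⁆ Module.End F R) (Θ : R →ₗ[F] X)
    (hΘ : ∀ s r, Θ (ρ s r) = φ s (Θ r)) (hinj : Function.Injective Θ)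
    (hX : 𝔉 (SplitExt φ)) : 𝔉 (SplitExt ρ) :=
  h𝔉.splitExt_of_subquotient φ ρ ρ Θ LinearMap.id hΘ (fun _ _ => rfl) Function.surjective_id
    (by rw [LinearMap.ker_eq_bot.2 hinj]; exact bot_le) hX

theorem splitExt_of_surjective {X Q : Type u} [AddCommGroup X] [Module F X] [AddCommGroup Q]
    [Module F Q] (φ : S →ₗ⁅F⁆ Module.End F X) (χ : S →ₗ⁅F⁆ Module.End F Q) (ψ : X →ₗ[F] Q)
    (hψ : ∀ s r, ψ (φ s r) = χ s (ψ r)) (hsurj : Function.Surjective ψ)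
    (hX : 𝔉 (SplitExt φ)) : 𝔉 (SplitExt χ) :=
  h𝔉.splitExt_of_subquotient φ φ χ LinearMap.id ψ (fun _ _ => rfl) hψ hsurj
    (by rw [LinearMap.ker_id]; exact bot_le) hX

end IsSaturatedFormation

/-- The representation on functions into a module. -/
def piRep {F S V : Type*} [CommRing F] [LieRing S] [LieAlgebra F S] [AddCommGroup V]
    [Module F V] (φ : S →ₗ⁅F⁆ Module.End F V) (ι : Type*) : S →ₗ⁅F⁆ Module.End F (ι → V) where
  toFun s := LinearMap.pi fun k => φ s ∘ₗ LinearMap.proj k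
  map_add' a b := by ext; simp
  map_smul' c a := by ext; simp
  map_lie' {a b} := LinearMap.ext fun v => funext fun k => by simp [Ring.lie_def]

namespace IsSaturatedFormation

variable {F : Type u} [Field F] {𝔉 : LieAlgClass F} (h𝔉 : IsSaturatedFormation 𝔉)
  {S : Type u} [LieRing S] [LieAlgebra F S]
include h𝔉

/-- If the irreducible submodule `A` lies in the Frattini subalgebra of the split extension of `V`,
saturation applies; otherwise a maximal subalgebra complements `A`, and the split extension of `V`
is a subdirect product of those of `V / A` and of `A`. -/
theorem splitExt_of_irreducible_extension {A V B : Type u} [AddCommGroup A] [Module F A]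
    [AddCommGroup V] [Module F V] [AddCommGroup B] [Module F B] (α : S →ₗ⁅F⁆ Module.End F A)
    (φ : S →ₗ⁅F⁆ Module.End F V) (β : S →ₗ⁅F⁆ Module.End F B) (i : A →ₗ[F] V) (π : V →ₗ[F] B)
    [FiniteDimensional F V] [FiniteDimensional F S]
    (hi : ∀ s a, i (α s a) = φ s (i a)) (hπ : ∀ s v, π (φ s v) = β s (π v))
    (hsurj : Function.Surjective π)
    (hex : LinearMap.ker π = LinearMap.range i)
    (hirr : ∀ A' : Submodule F A, (∀ s, ∀ a ∈ A', α s a ∈ A') → A' = ⊥ ∨ A' = ⊤)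
    (hA : 𝔉 (SplitExt α)) (hB : 𝔉 (SplitExt β)) : 𝔉 (SplitExt φ) := by
  let f : SplitExt φ →ₗ⁅F⁆ SplitExt β := SplitExt.map φ β π LieHom.id hπ
  have hf : Function.Surjective f := SplitExt.map_surjective _ _ _ hsurj Function.surjective_id
  let j : A →ₗ[F] SplitExt φ :=
    { toFun := fun a => ⟨i a, 0⟩
      map_add' := fun a b => by ext <;> simp
      map_smul' := fun c a => by ext <;> simp }
  have hker : ∀ x, f x = 0 → ∃ a, x = j a := by
    intro x hx
    have h1 : x.vec ∈ LinearMap.ker π := congrArg SplitExt.vec hx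
    have h2 : x.alg = 0 := congrArg SplitExt.alg hx
    rw [hex] at h1
    obtain ⟨a, ha⟩ := h1
    exact ⟨a, SplitExt.ext ha.symm h2⟩
  have hjlie : ∀ (x : SplitExt φ) a, ⁅x, j a⁆ = j (α x.alg a) := fun x a => by
    ext <;> simp [j, hi]
  have hjj : ∀ a b, ⁅j a, j b⁆ = 0 := fun a b => by ext <;> simp [j]
  by_cases hM : ∀ M : LieSubalgebra F (SplitExt φ), IsCoatom M → ∀ x, f x = 0 → x ∈ M
  · refine h𝔉.of_ker_le_frattini f hf ?_ hM hB
    intro x y hx hy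
    obtain ⟨a, rfl⟩ := hker x hx
    obtain ⟨b, rfl⟩ := hker y hy
    exact hjj a b
  push Not at hM
  obtain ⟨M, hMc, x₀, hx₀, hx₀M⟩ := hM
  obtain ⟨a₀, rfl⟩ := hker x₀ hx₀
  -- `M` and the image of `A` span the split extension
  have hspan : ∀ x : SplitExt φ, ∃ m ∈ M, ∃ a, x = m + j a := by
    intro x
    obtain ⟨m, hm, k, hk, rfl⟩ := LieSubalgebra.exists_add_of_isCoatom f hMc hx₀ hx₀M x
    obtain ⟨a, rfl⟩ := hker k hk
    exact ⟨m, hm, a, rfl⟩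
  -- and they meet trivially, `A` being irreducible
  have hdisj : ∀ a, j a ∈ M → a = 0 := by
    have h := hirr (M.toSubmodule.comap j) (by
      intro s a ha
      obtain ⟨m, hm, b, hmb⟩ := hspan ⟨0, s⟩
      have h1 : j (α s a) = ⁅m, j a⁆ := by
        have := hjlie ⟨0, s⟩ a
        rw [← this, hmb, add_lie, hjj, add_zero]
      change j (α s a) ∈ M
      rw [h1]
      exact M.lie_mem hm ha)
    rcases h with h | h
    · intro a ha
      have : a ∈ M.toSubmodule.comap j := ha
      rwa [h, Submodule.mem_bot] at this
    · refine absurd ?_ hx₀M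
      have : a₀ ∈ M.toSubmodule.comap j := by rw [h]; trivial
      exact this
  let e : A ≃ₗ[F] SplitExt φ ⧸ M.toSubmodule := LinearEquiv.ofBijective (M.toSubmodule.mkQ ∘ₗ j) (by
    refine ⟨(injective_iff_map_eq_zero _).2 fun a ha => hdisj a ?_, fun y => ?_⟩
    · simpa using ha
    · obtain ⟨x, rfl⟩ := M.toSubmodule.mkQ_surjective y
      obtain ⟨m, hm, a, rfl⟩ := hspan x
      refine ⟨a, ?_⟩
      have : M.toSubmodule.mkQ m = 0 := by simpa using hm
      rw [map_add, this, zero_add]; rfl)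
  let q : SplitExt φ →ₗ[F] A := e.symm.toLinearMap ∘ₗ M.toSubmodule.mkQ
  have hqj : ∀ a, q (j a) = a := fun a => e.symm_apply_apply a
  have hqM : ∀ m ∈ M, q m = 0 := fun m hm => by
    have : M.toSubmodule.mkQ m = 0 := by simpa using hm
    simp only [q, LinearMap.comp_apply, this, map_zero]
  have hq : ∀ m ∈ M, ∀ a, q (m + j a) = a := fun m hm a => by rw [map_add, hqM m hm, hqj, zero_add]
  let g : SplitExt φ →ₗ⁅F⁆ SplitExt α :=
    { toFun := fun x => ⟨q x, x.alg⟩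
      map_add' := fun x y => by ext <;> simp
      map_smul' := fun c x => by ext <;> simp
      map_lie' := by
        intro x y
        ext
        · obtain ⟨m, hm, a, rfl⟩ := hspan x
          obtain ⟨n, hn, b, rfl⟩ := hspan y
          have h1 : ⁅m + j a, n + j b⁆ = ⁅m, n⁆ + j (α m.alg b - α n.alg a) := by
            rw [lie_add, add_lie, add_lie, hjj, ← lie_skew (j a) n, hjlie, hjlie, map_sub]
            abel
          have h2 : ∀ a, (j a).alg = 0 := fun a => rfl
          simp only [SplitExt.vec_lie, h1, hq _ (M.lie_mem hm hn), hq m hm, hq n hn,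
            SplitExt.alg_add, h2, add_zero]
        · simp }
  refine h𝔉.of_subdirect f hf g ?_ ?_ hB hA
  · rintro ⟨a, s⟩
    obtain ⟨m, hm, b, hmb⟩ := hspan ⟨0, s⟩
    refine ⟨m + j a, SplitExt.ext (hq m hm a) ?_⟩
    have := congrArg SplitExt.alg hmb
    simpa [j, g] using this.symm
  · intro x h1 h2
    obtain ⟨a, rfl⟩ := hker x h1
    have : a = 0 := by
      have := congrArg SplitExt.vec h2
      rwa [show (g (j a)).vec = q (j a) from rfl, hqj] at this
    rw [this, map_zero]

theorem splitExt_of_extension {A V B : Type u} [AddCommGroup A] [Module F A]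
    [AddCommGroup V] [Module F V] [AddCommGroup B] [Module F B] (α : S →ₗ⁅F⁆ Module.End F A)
    (φ : S →ₗ⁅F⁆ Module.End F V) (β : S →ₗ⁅F⁆ Module.End F B) (i : A →ₗ[F] V) (π : V →ₗ[F] B)
    [FiniteDimensional F V] [FiniteDimensional F S]
    (hi : ∀ s a, i (α s a) = φ s (i a)) (hπ : ∀ s v, π (φ s v) = β s (π v))
    (hinj : Function.Injective i) (hsurj : Function.Surjective π)
    (hex : LinearMap.ker π = LinearMap.range i)
    (hA : 𝔉 (SplitExt α)) (hB : 𝔉 (SplitExt β)) : 𝔉 (SplitExt φ) := by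
  induction hn : Module.finrank F A using Nat.strong_induction_on generalizing A V B with
  | _ n ih =>
  have : FiniteDimensional F A := FiniteDimensional.of_injective i hinj
  by_cases hirr : ∀ A' : Submodule F A, (∀ s, ∀ a ∈ A', α s a ∈ A') → A' = ⊥ ∨ A' = ⊤
  · exact h𝔉.splitExt_of_irreducible_extension α φ β i π hi hπ hsurj hex hirr hA hB
  push Not at hirr
  obtain ⟨A', hA', hbot, htop⟩ := hirr
  have hA'V : ∀ s, ∀ v ∈ A'.map i, φ s v ∈ A'.map i := by
    rintro s _ ⟨a, ha, rfl⟩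
    exact ⟨α s a, hA' s a ha, hi s a⟩
  have hleπ : A'.map i ≤ LinearMap.ker π := by
    rw [hex]; exact LinearMap.map_le_range
  have hlei : A' ≤ (A'.map i).comap i := Submodule.le_comap_map i A'
  have hsub : 𝔉 (SplitExt (subRep α A' hA')) :=
    h𝔉.splitExt_of_injective α _ A'.subtype (fun _ _ => rfl) A'.subtype_injective hA
  have hquot : 𝔉 (SplitExt (quotRep α A' hA')) :=
    h𝔉.splitExt_of_surjective α _ A'.mkQ (fun _ _ => rfl) A'.mkQ_surjective hA
  have hmid : 𝔉 (SplitExt (quotRep φ (A'.map i) hA'V)) := by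
    refine ih (Module.finrank F (A ⧸ A')) ?_ (quotRep α A' hA') _ β
      (A'.mapQ (A'.map i) i hlei) ((A'.map i).liftQ π hleπ) ?_ ?_ ?_ ?_ ?_ hquot hB rfl
    · have h1 := A'.finrank_quotient_add_finrank
      have h2 : 0 < Module.finrank F A' :=
        Nat.pos_of_ne_zero fun h => hbot (Submodule.finrank_eq_zero.1 h)
      omega
    · intro s a
      obtain ⟨a, rfl⟩ := A'.mkQ_surjective a
      change (A'.map i).mkQ (i (α s a)) = (A'.map i).mkQ (φ s (i a))
      rw [hi]
    · intro s v
      obtain ⟨v, rfl⟩ := (A'.map i).mkQ_surjective v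
      exact hπ s v
    · rw [← LinearMap.ker_eq_bot, Submodule.ker_mapQ, Submodule.comap_map_eq_of_injective hinj]
      simp
    · intro b
      obtain ⟨v, rfl⟩ := hsurj b
      exact ⟨(A'.map i).mkQ v, by simp⟩
    · rw [Submodule.ker_liftQ, Submodule.range_mapQ, hex]
  refine ih (Module.finrank F A') ?_ (subRep α A' hA') φ _ (i ∘ₗ A'.subtype) (A'.map i).mkQ
    (fun s a => hi s a) (fun _ _ => rfl) (hinj.comp A'.subtype_injective)
    (A'.map i).mkQ_surjective ?_ hsub hmid rfl
  · rw [← hn]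
    exact Submodule.finrank_lt htop
  · rw [Submodule.ker_mkQ, LinearMap.range_comp, Submodule.range_subtype]

theorem splitExt_of_subsingleton {V : Type u} [AddCommGroup V] [Module F V] [Subsingleton V]
    (φ : S →ₗ⁅F⁆ Module.End F V) (hS : 𝔉 S) : 𝔉 (SplitExt φ) :=
  h𝔉.of_surjective
    { toFun := fun s => ⟨0, s⟩
      map_add' := fun a b => by ext <;> simp
      map_smul' := fun c a => by ext <;> simp
      map_lie' := fun {a b} => by ext <;> simp }
    (fun x => ⟨x.alg, SplitExt.ext (Subsingleton.elim _ _) rfl⟩) hS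

theorem splitExt_piRep {V : Type u} [AddCommGroup V] [Module F V]
    (φ : S →ₗ⁅F⁆ Module.End F V) (hS : 𝔉 S) (hφ : 𝔉 (SplitExt φ)) (n : ℕ) :
    𝔉 (SplitExt (piRep φ (Fin n))) := by
  have := h𝔉.finite S hS
  have := h𝔉.finite _ hφ
  have := SplitExt.finite_vec φ
  induction n with
  | zero => exact h𝔉.splitExt_of_subsingleton _ hS
  | succ n ih =>
    refine h𝔉.splitExt_of_extension φ _ (piRep φ (Fin n)) (LinearMap.single F (fun _ => V) 0)
      (LinearMap.funLeft F V Fin.succ) ?_ (fun _ _ => rfl) (Pi.single_injective (M := fun _ => V) 0)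
      (LinearMap.funLeft_surjective_of_injective _ _ _ (Fin.succ_injective n)) ?_ hφ ih
    · intro s a
      ext k
      refine Fin.cases ?_ (fun k => ?_) k
      · change Pi.single (M := fun _ => V) 0 (φ s a) 0 = φ s (Pi.single (M := fun _ => V) 0 a 0)
        simp
      · change Pi.single (M := fun _ => V) 0 (φ s a) k.succ =
          φ s (Pi.single (M := fun _ => V) 0 a k.succ)
        simp
    · ext v
      simp only [LinearMap.mem_ker, LinearMap.mem_range]
      constructor
      · intro h
        refine ⟨v 0, funext fun k => ?_⟩
        refine Fin.cases (by simp) (fun k => ?_) k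
        have := congrFun h k
        simp only [LinearMap.funLeft_apply, Pi.zero_apply] at this
        simp [this]
      · rintro ⟨a, rfl⟩
        ext k
        simp
end IsSaturatedFormation

/-! ### Tensor products and saturated formations -/

/-- The tensor product of two representations. -/
def tensorRep {F S V W : Type*} [CommRing F] [LieRing S] [LieAlgebra F S] [AddCommGroup V]
    [Module F V] [AddCommGroup W] [Module F W] (ψ : S →ₗ⁅F⁆ Module.End F V)
    (χ : S →ₗ⁅F⁆ Module.End F W) : S →ₗ⁅F⁆ Module.End F (V ⊗[F] W) where
  toFun s := (ψ s).rTensor W + (χ s).lTensor V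
  map_add' a b := by
    refine TensorProduct.ext' fun v w => ?_
    simp; abel
  map_smul' c a := by
    refine TensorProduct.ext' fun v w => ?_
    simp [TensorProduct.smul_tmul']
  map_lie' {a b} := by
    refine TensorProduct.ext' fun v w => ?_
    simp [Ring.lie_def]; abel

@[simp] theorem tensorRep_tmul {F S V W : Type*} [CommRing F] [LieRing S] [LieAlgebra F S]
    [AddCommGroup V] [Module F V] [AddCommGroup W] [Module F W] (ψ : S →ₗ⁅F⁆ Module.End F V)
    (χ : S →ₗ⁅F⁆ Module.End F W) (s : S) (v : V) (w : W) :
    tensorRep ψ χ s (v ⊗ₜ w) = ψ s v ⊗ₜ w + v ⊗ₜ χ s w := rfl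

/-- The product of two representations. -/
def prodRep {F S V W : Type*} [CommRing F] [LieRing S] [LieAlgebra F S] [AddCommGroup V]
    [Module F V] [AddCommGroup W] [Module F W] (ψ : S →ₗ⁅F⁆ Module.End F V)
    (χ : S →ₗ⁅F⁆ Module.End F W) : S →ₗ⁅F⁆ Module.End F (V × W) where
  toFun s := (ψ s).prodMap (χ s)
  map_add' a b := by ext <;> simp
  map_smul' c a := by ext <;> simp
  map_lie' {a b} := LinearMap.ext fun v => by simp [Ring.lie_def]

/-- The vector space underlying the split extension by `S` of the nilpotent Lie algebra
`V ⊕ W ⊕ V ⊗ W` of class two in which `[v, w] = v ⊗ w`. -/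
@[ext] structure HeisenbergExt {F S V W : Type*} [CommRing F] [LieRing S] [LieAlgebra F S]
    [AddCommGroup V] [Module F V] [AddCommGroup W] [Module F W] (ψ : S →ₗ⁅F⁆ Module.End F V)
    (χ : S →ₗ⁅F⁆ Module.End F W) where
  /-- the component in the complement `S` -/
  alg : S
  /-- the component in `V` -/
  fst : V
  /-- the component in `W` -/
  snd : W
  /-- the component in the central ideal `V ⊗ W` of the nilpotent part -/
  ten : V ⊗[F] W

namespace HeisenbergExt

variable {F S V W : Type*} [CommRing F] [LieRing S] [LieAlgebra F S]
    [AddCommGroup V] [Module F V] [AddCommGroup W] [Module F W] (ψ : S →ₗ⁅F⁆ Module.End F V)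
    (χ : S →ₗ⁅F⁆ Module.End F W)

/-- As a type, the extension is a product. -/
def toProd : HeisenbergExt ψ χ ≃ S × V × W × (V ⊗[F] W) where
  toFun a := (a.alg, a.fst, a.snd, a.ten)
  invFun a := ⟨a.1, a.2.1, a.2.2.1, a.2.2.2⟩
  left_inv _ := rfl
  right_inv _ := rfl

instance : AddCommGroup (HeisenbergExt ψ χ) := (toProd ψ χ).addCommGroup

instance : Module F (HeisenbergExt ψ χ) := (toProd ψ χ).module F

instance : Bracket (HeisenbergExt ψ χ) (HeisenbergExt ψ χ) :=
  ⟨fun a b => ⟨⁅a.alg, b.alg⁆, ψ a.alg b.fst - ψ b.alg a.fst, χ a.alg b.snd - χ b.alg a.snd,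
    tensorRep ψ χ a.alg b.ten - tensorRep ψ χ b.alg a.ten
      + (a.fst ⊗ₜ b.snd - b.fst ⊗ₜ a.snd)⟩⟩

variable {ψ χ}

@[simp] theorem alg_add (s t : HeisenbergExt ψ χ) : (s + t).alg = s.alg + t.alg := rfl
@[simp] theorem fst_add (s t : HeisenbergExt ψ χ) : (s + t).fst = s.fst + t.fst := rfl
@[simp] theorem snd_add (s t : HeisenbergExt ψ χ) : (s + t).snd = s.snd + t.snd := rfl
@[simp] theorem ten_add (s t : HeisenbergExt ψ χ) : (s + t).ten = s.ten + t.ten := rfl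
@[simp] theorem alg_zero : (0 : HeisenbergExt ψ χ).alg = 0 := rfl
@[simp] theorem fst_zero : (0 : HeisenbergExt ψ χ).fst = 0 := rfl
@[simp] theorem snd_zero : (0 : HeisenbergExt ψ χ).snd = 0 := rfl
@[simp] theorem ten_zero : (0 : HeisenbergExt ψ χ).ten = 0 := rfl
@[simp] theorem alg_smul (c : F) (s : HeisenbergExt ψ χ) : (c • s).alg = c • s.alg := rfl
@[simp] theorem fst_smul (c : F) (s : HeisenbergExt ψ χ) : (c • s).fst = c • s.fst := rfl
@[simp] theorem snd_smul (c : F) (s : HeisenbergExt ψ χ) : (c • s).snd = c • s.snd := rfl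
@[simp] theorem ten_smul (c : F) (s : HeisenbergExt ψ χ) : (c • s).ten = c • s.ten := rfl
@[simp] theorem alg_lie (a b : HeisenbergExt ψ χ) : ⁅a, b⁆.alg = ⁅a.alg, b.alg⁆ := rfl
@[simp] theorem fst_lie (a b : HeisenbergExt ψ χ) :
    ⁅a, b⁆.fst = ψ a.alg b.fst - ψ b.alg a.fst := rfl
@[simp] theorem snd_lie (a b : HeisenbergExt ψ χ) :
    ⁅a, b⁆.snd = χ a.alg b.snd - χ b.alg a.snd := rfl
@[simp] theorem ten_lie (a b : HeisenbergExt ψ χ) :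
    ⁅a, b⁆.ten = tensorRep ψ χ a.alg b.ten - tensorRep ψ χ b.alg a.ten
      + (a.fst ⊗ₜ b.snd - b.fst ⊗ₜ a.snd) := rfl

instance : LieRing (HeisenbergExt ψ χ) where
  add_lie s t r := by
    ext <;> simp [TensorProduct.add_tmul, TensorProduct.tmul_add] <;> abel
  lie_add s t r := by
    ext <;> simp [TensorProduct.add_tmul, TensorProduct.tmul_add] <;> abel
  lie_self s := by ext <;> simp
  leibniz_lie s t r := by
    ext
    · simp
    · simp [LieHom.map_lie, Ring.lie_def]; abel
    · simp [LieHom.map_lie, Ring.lie_def]; abel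
    · simp [LieHom.map_lie, Ring.lie_def, TensorProduct.sub_tmul, TensorProduct.tmul_sub]; abel

instance : LieAlgebra F (HeisenbergExt ψ χ) where
  lie_smul c s t := by
    ext <;> simp [smul_sub, smul_add, TensorProduct.smul_tmul', TensorProduct.tmul_smul]

variable (ψ χ)

instance [Module.Finite F V] [Module.Finite F W] [Module.Finite F S] :
    Module.Finite F (HeisenbergExt ψ χ) :=
  Module.Finite.equiv (M := S × V × W × (V ⊗[F] W))
    { (toProd ψ χ).symm with
      map_add' := fun _ _ => rfl
      map_smul' := fun _ _ => rfl }

end HeisenbergExt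

namespace IsSaturatedFormation

variable {F : Type u} [Field F] {𝔉 : LieAlgClass F} (h𝔉 : IsSaturatedFormation 𝔉)
  {S : Type u} [LieRing S] [LieAlgebra F S]
include h𝔉

theorem splitExt_prodRep {V W : Type u} [AddCommGroup V] [Module F V] [AddCommGroup W]
    [Module F W] (ψ : S →ₗ⁅F⁆ Module.End F V) (χ : S →ₗ⁅F⁆ Module.End F W) (hS : 𝔉 S)
    (hψ : 𝔉 (SplitExt ψ)) (hχ : 𝔉 (SplitExt χ)) : 𝔉 (SplitExt (prodRep ψ χ)) := by
  have := h𝔉.finite S hS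
  have := h𝔉.finite _ hψ
  have := h𝔉.finite _ hχ
  have := SplitExt.finite_vec ψ
  have := SplitExt.finite_vec χ
  refine h𝔉.splitExt_of_extension ψ _ χ (LinearMap.inl F V W) (LinearMap.snd F V W)
    (fun s a => ?_) (fun _ _ => rfl) LinearMap.inl_injective LinearMap.snd_surjective
    (LinearMap.ker_snd F V W) hψ hχ
  change (ψ s a, (0 : W)) = (ψ s a, χ s 0)
  simp

/-- `V ⊗ W` lies in the derived algebra of the nilpotent ideal `V ⊕ W ⊕ V ⊗ W` of its split
extension by `S`, hence in the Frattini subalgebra. -/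
theorem splitExt_tensorRep {V W : Type u} [AddCommGroup V] [Module F V] [AddCommGroup W]
    [Module F W] (ψ : S →ₗ⁅F⁆ Module.End F V) (χ : S →ₗ⁅F⁆ Module.End F W) (hS : 𝔉 S)
    (hψ : 𝔉 (SplitExt ψ)) (hχ : 𝔉 (SplitExt χ)) : 𝔉 (SplitExt (tensorRep ψ χ)) := by
  have := h𝔉.finite S hS
  have := h𝔉.finite _ hψ
  have := h𝔉.finite _ hχ
  have := SplitExt.finite_vec ψ
  have := SplitExt.finite_vec χ
  let f : HeisenbergExt ψ χ →ₗ⁅F⁆ SplitExt (prodRep ψ χ) :=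
    { toFun := fun a => ⟨(a.fst, a.snd), a.alg⟩
      map_add' := fun _ _ => rfl
      map_smul' := fun _ _ => rfl
      map_lie' := rfl }
  let g : HeisenbergExt ψ χ →ₗ⁅F⁆ S :=
    { toFun := fun a => a.alg
      map_add' := fun _ _ => rfl
      map_smul' := fun _ _ => rfl
      map_lie' := rfl }
  let j : V ⊗[F] W →ₗ[F] HeisenbergExt ψ χ :=
    { toFun := fun t => ⟨0, 0, 0, t⟩
      map_add' := fun _ _ => by ext <;> simp
      map_smul' := fun _ _ => by ext <;> simp }
  have hker : ∀ x, f x = 0 → ∃ t, x = j t := fun x hx => by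
    have h1 := congrArg SplitExt.vec hx
    refine ⟨x.ten, HeisenbergExt.ext (congrArg SplitExt.alg hx) (congrArg Prod.fst h1)
      (congrArg Prod.snd h1) rfl⟩
  have hjj : ∀ a b, ⁅j a, j b⁆ = 0 := fun a b => by ext <;> simp [j]
  have hX : 𝔉 (HeisenbergExt ψ χ) := by
    refine h𝔉.of_ker_le_frattini f (fun a => ⟨⟨a.alg, a.vec.1, a.vec.2, 0⟩, rfl⟩) ?_ ?_
      (h𝔉.splitExt_prodRep ψ χ hS hψ hχ)
    · intro x y hx hy
      obtain ⟨a, rfl⟩ := hker x hx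
      obtain ⟨b, rfl⟩ := hker y hy
      exact hjj a b
    · intro M hM x₀ hx₀
      by_contra hx₀M
      have hall : ∀ t, j t ∈ M := by
        intro t
        induction t with
        | zero => rw [map_zero]; exact zero_mem _
        | add a b ha hb => rw [map_add]; exact add_mem ha hb
        | tmul v w =>
          obtain ⟨m, hm, k, hk, hmk⟩ :=
            LieSubalgebra.exists_add_of_isCoatom f hM hx₀ hx₀M ⟨0, v, 0, 0⟩
          obtain ⟨n, hn, l, hl, hnl⟩ :=
            LieSubalgebra.exists_add_of_isCoatom f hM hx₀ hx₀M ⟨0, 0, w, 0⟩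
          obtain ⟨a, rfl⟩ := hker k hk
          obtain ⟨b, rfl⟩ := hker l hl
          have h : j (v ⊗ₜ w) = ⁅m, n⁆ := by
            rw [eq_sub_of_add_eq hmk.symm, eq_sub_of_add_eq hnl.symm, sub_eq_add_neg,
              sub_eq_add_neg, ← map_neg, ← map_neg]
            ext <;> simp [j]
          rw [h]
          exact M.lie_mem hm hn
      obtain ⟨t, rfl⟩ := hker x₀ hx₀
      exact hx₀M (hall t)
  have h1 : 𝔉 (SplitExt ((tensorRep ψ χ).comp g)) :=
    h𝔉.splitExt_of_abelian_ideal _ j (fun a b hab => congrArg HeisenbergExt.ten hab)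
      (fun e a => HeisenbergExt.ext (by simp [j]) (by simp [j]) (by simp [j])
      (by simp [j]; rfl)) hjj hX
  exact h𝔉.of_surjective (SplitExt.map _ (tensorRep ψ χ) LinearMap.id g fun _ _ => rfl)
    (SplitExt.map_surjective _ _ _ Function.surjective_id fun s => ⟨⟨s, 0, 0, 0⟩, rfl⟩) h1

/-- Here `S ≠ 0` matters: it gives the formation a one-dimensional member. -/
theorem splitExt_trivialRep [Nontrivial S] (hS : 𝔉 S) (T : Type u) [AddCommGroup T] [Module F T]
    [FiniteDimensional F T] : 𝔉 (SplitExt (0 : S →ₗ⁅F⁆ Module.End F T)) := by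
  have := h𝔉.soluble S hS
  have := h𝔉.finite S hS
  obtain ⟨l, hl0, hl⟩ := Submodule.exists_le_ker_of_lt_top
    (LieAlgebra.derivedSeries F S 1).toSubmodule
    ((LieSubmodule.toSubmodule_orderEmbedding F S S).lt_iff_lt.2
      (LieAlgebra.derivedSeries_lt_top_of_solvable F S))
  have hFF : 𝔉 F := by
    refine h𝔉.of_surjective
      ({ l with
         map_lie' := fun {a b} => ?_ } : S →ₗ⁅F⁆ F) (LinearMap.surjective hl0) hS
    have h : ⁅a, b⁆ ∈ LieAlgebra.derivedSeries F S 1 :=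
      LieSubmodule.lie_mem_lie (LieSubmodule.mem_top a) (LieSubmodule.mem_top b)
    have h2 : l ⁅a, b⁆ = 0 := hl h
    change l ⁅a, b⁆ = ⁅l a, l b⁆
    rw [h2, Ring.lie_def, mul_comm, sub_self]
  have h1 : 𝔉 (SplitExt (0 : S →ₗ⁅F⁆ Module.End F F)) := by
    refine h𝔉.of_subdirect (SplitExt.proj _) (SplitExt.proj_surjective _)
      ({ toFun := fun x => x.vec
         map_add' := fun _ _ => rfl
         map_smul' := fun _ _ => rfl
         map_lie' := fun {a b} => by simp [Ring.lie_def, mul_comm] } :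
         SplitExt (0 : S →ₗ⁅F⁆ Module.End F F) →ₗ⁅F⁆ F) (fun c => ⟨⟨c, 0⟩, rfl⟩) ?_ hS hFF
    intro x hx hx'
    exact SplitExt.ext hx' hx
  let e := (Module.finBasis F T).equivFun
  exact h𝔉.splitExt_of_surjective _ _ e.symm.toLinearMap
    (fun s r => by
      have : (piRep (0 : S →ₗ⁅F⁆ Module.End F F) (Fin (Module.finrank F T))) s r = 0 := rfl
      rw [this]; simp) e.symm.surjective
    (h𝔉.splitExt_piRep _ hS h1 (Module.finrank F T))

end IsSaturatedFormation

/-! ### The adjoint module and subnormal subalgebras -/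

/-- The quotient map of a Lie algebra by an ideal. -/
def LieIdeal.mkQ {F S : Type*} [CommRing F] [LieRing S] [LieAlgebra F S] (I : LieIdeal F S) :
    S →ₗ⁅F⁆ (S ⧸ I) where
  toLinearMap := I.toSubmodule.mkQ
  map_lie' := rfl

theorem LieIdeal.mkQ_surjective {F S : Type*} [CommRing F] [LieRing S] [LieAlgebra F S]
    (I : LieIdeal F S) : Function.Surjective I.mkQ :=
  Submodule.mkQ_surjective I.toSubmodule

theorem LieSubalgebra.nontrivial_of_ne_bot {F L : Type*} [CommRing F] [LieRing L] [LieAlgebra F L]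
    {S : LieSubalgebra F L} (h : S ≠ ⊥) : Nontrivial S := by
  by_contra hns
  rw [not_nontrivial_iff_subsingleton] at hns
  exact h ((LieSubalgebra.eq_bot_iff S).2 fun x hx =>
    congrArg Subtype.val (Subsingleton.elim (⟨x, hx⟩ : S) 0))

namespace IsSaturatedFormation

variable {F : Type u} [Field F] {𝔉 : LieAlgClass F} (h𝔉 : IsSaturatedFormation 𝔉)
include h𝔉

theorem splitExt_ad {S : Type u} [LieRing S] [LieAlgebra F S] (hS : 𝔉 S) :
    𝔉 (SplitExt (LieAlgebra.ad F S)) := by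
  induction hn : Module.finrank F S using Nat.strong_induction_on generalizing S with
  | _ n ih =>
  have := h𝔉.finite S hS
  have := h𝔉.soluble S hS
  cases subsingleton_or_nontrivial S
  · exact h𝔉.splitExt_of_subsingleton _ hS
  let A : LieIdeal F S := LieAlgebra.derivedAbelianOfIdeal (⊤ : LieIdeal F S)
  have hA0 : A ≠ ⊥ := fun h => by
    have : (⊤ : LieIdeal F S) = ⊥ := (LieAlgebra.abelian_of_solvable_ideal_eq_bot_iff _).1 h
    exact top_ne_bot this
  have hab : IsLieAbelian A := LieAlgebra.abelian_derivedAbelianOfIdeal ⊤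
  have hinv : ∀ s, ∀ x ∈ A.toSubmodule, LieAlgebra.ad F S s x ∈ A.toSubmodule :=
    fun s x hx => lie_mem_right F S A s x hx
  have hQ : 𝔉 (SplitExt (LieAlgebra.ad F (S ⧸ A))) := by
    refine ih _ ?_ (h𝔉.quotient S A hS) rfl
    have h1 := A.toSubmodule.finrank_quotient_add_finrank
    have h2 : 0 < Module.finrank F A.toSubmodule := Nat.pos_of_ne_zero fun h =>
      hA0 ((LieSubmodule.toSubmodule_eq_bot A).1 (Submodule.finrank_eq_zero.1 h))
    have h3 : Module.finrank F (S ⧸ A) = Module.finrank F (S ⧸ A.toSubmodule) := rfl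
    omega
  have h1 : 𝔉 (SplitExt (quotRep (LieAlgebra.ad F S) A.toSubmodule hinv)) := by
    refine h𝔉.of_subdirect (SplitExt.proj _) (SplitExt.proj_surjective _)
      (SplitExt.map _ (LieAlgebra.ad F (S ⧸ A)) LinearMap.id A.mkQ ?_)
      (SplitExt.map_surjective _ _ _ Function.surjective_id A.mkQ_surjective) ?_ hS hQ
    · intro s x
      obtain ⟨x, rfl⟩ := A.toSubmodule.mkQ_surjective x
      rfl
    · exact fun x hx hx' => SplitExt.ext (congrArg SplitExt.vec hx' :) hx
  have h2 : 𝔉 (SplitExt (subRep (LieAlgebra.ad F S) A.toSubmodule hinv)) :=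
    h𝔉.splitExt_of_abelian_ideal _ A.toSubmodule.subtype A.toSubmodule.subtype_injective
      (fun _ _ => rfl) (fun a b => congrArg Subtype.val (hab.trivial a b)) hS
  exact h𝔉.splitExt_of_extension _ _ _ A.toSubmodule.subtype A.toSubmodule.mkQ
    (fun _ _ => rfl) (fun _ _ => rfl) A.toSubmodule.subtype_injective
    A.toSubmodule.mkQ_surjective (by rw [Submodule.ker_mkQ, Submodule.range_subtype]) h2 h1

/-- Going up the chain from `S` to `L`, the subalgebra `S` acts trivially on each factor but the
first, which is the adjoint module of `S`. -/
theorem splitExt_ad_of_subnormal {L : Type u} [LieRing L] [LieAlgebra F L] [FiniteDimensional F L]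
    (S : LieSubalgebra F L) (hS : 𝔉 S) (hS0 : S ≠ ⊥) (hsub : IsSubnormalSubalgebra S) :
    𝔉 (SplitExt ((LieAlgebra.ad F L).comp S.incl)) := by
  have := LieSubalgebra.nontrivial_of_ne_bot hS0
  have key : ∀ H : LieSubalgebra F L, IsSubnormalSubalgebra H → S ≤ H →
      ∀ hH : ∀ s, ∀ x ∈ H.toSubmodule, ((LieAlgebra.ad F L).comp S.incl) s x ∈ H.toSubmodule,
      𝔉 (SplitExt (subRep _ H.toSubmodule hH)) →
      𝔉 (SplitExt ((LieAlgebra.ad F L).comp S.incl)) := by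
    intro H hH
    induction hH with
    | top =>
      intro _ hH h
      exact h𝔉.splitExt_of_surjective _ _ (⊤ : LieSubalgebra F L).toSubmodule.subtype
        (fun _ _ => rfl) (fun x => ⟨⟨x, LieSubalgebra.mem_top x⟩, rfl⟩) h
    | step H K hle hideal _ ih =>
      intro hSH hH h
      have hK : ∀ s, ∀ x ∈ K.toSubmodule,
          ((LieAlgebra.ad F L).comp S.incl) s x ∈ K.toSubmodule :=
        fun s x hx => K.lie_mem (hle (hSH s.2)) hx
      refine ih (hSH.trans hle) hK ?_
      refine h𝔉.splitExt_of_extension _ _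
        (0 : S →ₗ⁅F⁆ Module.End F (K.toSubmodule ⧸ H.toSubmodule.submoduleOf K.toSubmodule))
        (Submodule.inclusion hle) (Submodule.mkQ _) (fun _ _ => rfl) ?_
        (Submodule.inclusion_injective hle) (Submodule.mkQ_surjective _) ?_ h
        (h𝔉.splitExt_trivialRep hS _)
      · intro s v
        refine (Submodule.Quotient.mk_eq_zero _).2 ?_
        change ⁅(s : L), (v : L)⁆ ∈ H
        rw [← lie_skew]
        exact neg_mem (hideal _ v.2 _ (hSH s.2))
      · rw [Submodule.ker_mkQ, Submodule.range_inclusion]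
        rfl
  refine key S hsub le_rfl (fun s x hx => S.lie_mem s.2 hx) ?_
  exact h𝔉.splitExt_of_surjective _ _ (LinearMap.id : S →ₗ[F] S) (fun _ _ => rfl)
    Function.surjective_id (h𝔉.splitExt_ad hS)

end IsSaturatedFormation

/-! ### Hypercentral modules and split extensions -/

/-- A factor `N₂ / N₁` with no submodule strictly between `N₁` and `N₂` is irreducible. -/
theorem isIrreducible_moduleFactor {F L V : Type*} [CommRing F] [LieRing L] [LieAlgebra F L]
    [AddCommGroup V] [Module F V] [LieRingModule L V] [LieModule F L V]
    {N₁ N₂ : LieSubmodule F L V} (h : N₁ ⋖ N₂) :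
    LieModule.IsIrreducible F L (moduleFactor N₁ N₂) := by
  obtain ⟨x, hx2, hx1⟩ := SetLike.exists_of_lt h.lt
  have hne : LieSubmodule.Quotient.mk' (N₁.comap N₂.incl) ⟨x, hx2⟩ ≠ 0 := fun h0 =>
    hx1 ((LieSubmodule.Quotient.mk_eq_zero (N := N₁.comap N₂.incl)).1 h0)
  have : Nontrivial (moduleFactor N₁ N₂) := ⟨⟨_, _, hne⟩⟩
  refine LieModule.IsIrreducible.mk fun P hP => ?_
  let Q : LieSubmodule F L N₂ := P.comap (LieSubmodule.Quotient.mk' (N₁.comap N₂.incl))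
  have hmem : ∀ y (hy : y ∈ N₁), (⟨y, h.le hy⟩ : N₂) ∈ Q := fun y hy => by
    have h0 : LieSubmodule.Quotient.mk' (N₁.comap N₂.incl) ⟨y, h.le hy⟩ = 0 :=
      (LieSubmodule.Quotient.mk_eq_zero _).2 hy
    change LieSubmodule.Quotient.mk' (N₁.comap N₂.incl) ⟨y, h.le hy⟩ ∈ P
    rw [h0]
    exact zero_mem _
  have h1 : N₁ ≤ Q.map N₂.incl := fun y hy =>
    (LieSubmodule.mem_map _).2 ⟨⟨y, h.le hy⟩, hmem y hy, rfl⟩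
  have h2 : Q.map N₂.incl ≤ N₂ := fun y hy => by
    obtain ⟨z, _, rfl⟩ := (LieSubmodule.mem_map _).1 hy
    exact z.2
  rcases h.eq_or_eq h1 h2 with h3 | h3
  · refine absurd ?_ hP
    rw [eq_bot_iff]
    intro p hp
    obtain ⟨y, rfl⟩ := LieSubmodule.Quotient.surjective_mk' _ p
    have : (y : V) ∈ Q.map N₂.incl := (LieSubmodule.mem_map _).2 ⟨y, hp, rfl⟩
    rw [h3] at this
    exact (LieSubmodule.mem_bot _).2 ((LieSubmodule.Quotient.mk_eq_zero _).2 this)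
  · rw [eq_top_iff]
    intro p _
    obtain ⟨y, rfl⟩ := LieSubmodule.Quotient.surjective_mk' _ p
    have hy : (y : V) ∈ Q.map N₂.incl := h3.symm.le y.2
    obtain ⟨z, hz, hzy⟩ := (LieSubmodule.mem_map _).1 hy
    have : z = y := Subtype.ext hzy
    rw [← this]
    exact hz

namespace IsSaturatedFormation

variable {F : Type u} [Field F] {𝔉 : LieAlgClass F} (h𝔉 : IsSaturatedFormation 𝔉)
  {S : Type u} [LieRing S] [LieAlgebra F S]
include h𝔉

theorem isFHypercentral_of_splitExt {V : Type u} [AddCommGroup V] [Module F V]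
    [LieRingModule S V] [LieModule F S V] (h : 𝔉 (SplitExt (LieModule.toEnd F S V))) :
    IsFHypercentral 𝔉 S V := by
  intro N₁ N₂ _ hirr
  refine ⟨hirr, ?_⟩
  have h1 : 𝔉 (SplitExt (LieModule.toEnd F S N₂)) :=
    h𝔉.splitExt_of_injective _ _ (N₂.incl : N₂ →ₗ[F] V) (fun _ _ => rfl)
      Subtype.val_injective h
  have h2 : 𝔉 (SplitExt (LieModule.toEnd F S (moduleFactor N₁ N₂))) :=
    h𝔉.splitExt_of_surjective _ _
      (LieSubmodule.Quotient.mk' (N₁.comap N₂.incl) : N₂ →ₗ[F] moduleFactor N₁ N₂)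
      (fun _ _ => rfl) (LieSubmodule.Quotient.surjective_mk' _) h1
  exact h𝔉.of_surjective (SplitExt.map _ _ LinearMap.id (LieIdeal.mkQ _) fun _ _ => rfl)
    (SplitExt.map_surjective _ _ _ Function.surjective_id (LieIdeal.mkQ_surjective _)) h2

theorem splitExt_of_isFHypercentral {V : Type u} [AddCommGroup V] [Module F V]
    [FiniteDimensional F V] [LieRingModule S V] [LieModule F S V] (hS : 𝔉 S)
    (h : IsFHypercentral 𝔉 S V) : 𝔉 (SplitExt (LieModule.toEnd F S V)) := by
  have := h𝔉.finite S hS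
  have hbot : 𝔉 (SplitExt (LieModule.toEnd F S (⊥ : LieSubmodule F S V))) :=
    h𝔉.splitExt_of_subsingleton _ hS
  obtain ⟨W, hW, hmax⟩ := (wellFounded_gt (α := LieSubmodule F S V)).has_min
    {N | 𝔉 (SplitExt (LieModule.toEnd F S N))} ⟨⊥, hbot⟩
  by_cases htop : W = ⊤
  · subst htop
    exact h𝔉.splitExt_of_surjective _ _ (⊤ : LieSubmodule F S V).toSubmodule.subtype
      (fun _ _ => rfl) (fun v => ⟨⟨v, LieSubmodule.mem_top v⟩, rfl⟩) hW
  have := LieSubmodule.wellFoundedLT_of_isArtinian F S V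
  obtain ⟨N, hN⟩ := exists_covBy_of_wellFoundedLT (fun hm => htop (isMax_iff_eq_top.1 hm))
  refine absurd hN.lt (hmax N ?_)
  have hc := h W N hN.le (isIrreducible_moduleFactor hN)
  have hf : 𝔉 (SplitExt (LieModule.toEnd F S (moduleFactor W N))) := by
    refine h𝔉.of_subdirect (SplitExt.proj _) (SplitExt.proj_surjective _)
      (SplitExt.map _ (quotientRep F S (moduleFactor W N)) LinearMap.id (LieIdeal.mkQ _)
        fun _ _ => rfl)
      (SplitExt.map_surjective _ _ _ Function.surjective_id (LieIdeal.mkQ_surjective _)) ?_ hS hc.2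
    exact fun x hx hx' => SplitExt.ext (congrArg SplitExt.vec hx' :) hx
  refine h𝔉.splitExt_of_extension (LieModule.toEnd F S W) (LieModule.toEnd F S N)
    (LieModule.toEnd F S (moduleFactor W N)) (Submodule.inclusion hN.le)
    (LieSubmodule.Quotient.mk' (W.comap N.incl) : N →ₗ[F] moduleFactor W N)
    (fun _ _ => rfl) (fun _ _ => rfl) (Submodule.inclusion_injective hN.le)
    (LieSubmodule.Quotient.surjective_mk' _) ?_ hW hf
  rw [Submodule.range_inclusion]
  exact Submodule.ker_mkQ _

end IsSaturatedFormation

/-! ### The enveloping algebra and its comultiplication -/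

theorem LinearMap.exists_comp_eq_of_ker_le {F U Y A : Type*} [Field F] [AddCommGroup U] [Module F U]
    [AddCommGroup Y] [Module F Y] [AddCommGroup A] [Module F A] (f : U →ₗ[F] Y) (g : U →ₗ[F] A)
    (h : ∀ u, f u = 0 → g u = 0) : ∃ k : Y →ₗ[F] A, ∀ u, k (f u) = g u := by
  obtain ⟨k, hk⟩ := LinearMap.exists_extend
    ((LinearMap.ker f).liftQ g (fun u hu => h u hu) ∘ₗ f.quotKerEquivRange.symm.toLinearMap)
  refine ⟨k, fun u => ?_⟩
  have h1 : f.quotKerEquivRange.symm ⟨f u, u, rfl⟩ = (LinearMap.ker f).mkQ u := by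
    rw [LinearEquiv.symm_apply_eq]; rfl
  have h2 := LinearMap.congr_fun hk ⟨f u, u, rfl⟩
  rw [LinearMap.comp_apply, LinearMap.comp_apply, LinearEquiv.coe_coe, h1] at h2
  exact h2

namespace UniversalEnvelopingAlgebra

variable {F L : Type*} [CommRing F] [LieRing L] [LieAlgebra F L]

theorem induction {P : UniversalEnvelopingAlgebra F L → Prop}
    (algebraMap : ∀ c : F, P (algebraMap F _ c)) (ι : ∀ x, P (ι F x))
    (mul : ∀ u v, P u → P v → P (u * v)) (add : ∀ u v, P u → P v → P (u + v))
    (u : UniversalEnvelopingAlgebra F L) : P u := by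
  let B : Subalgebra F (UniversalEnvelopingAlgebra F L) :=
    { carrier := {u | P u}
      mul_mem' := fun {a b} => mul a b
      add_mem' := fun {a b} => add a b
      algebraMap_mem' := algebraMap }
  let f : L →ₗ⁅F⁆ B :=
    { toFun := fun x => ⟨UniversalEnvelopingAlgebra.ι F x, ι x⟩
      map_add' := fun x y => Subtype.ext (map_add _ _ _)
      map_smul' := fun c x => Subtype.ext (map_smul _ _ _)
      map_lie' := fun {x y} => Subtype.ext (LieHom.map_lie _ _ _) }
  have h : B.val.comp (lift F f) = AlgHom.id F _ := by
    ext x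
    simp only [LieHom.comp_apply, AlgHom.coe_toLieHom, AlgHom.comp_apply, lift_ι_apply,
      AlgHom.id_apply]
    rfl
  have h2 := AlgHom.congr_fun h u
  rw [AlgHom.comp_apply, AlgHom.id_apply] at h2
  rw [← h2]
  exact (lift F f u).2

/-- An equivariant map between modules of a Lie algebra commutes with the enveloping algebra. -/
theorem lift_equivariant {X Z : Type*} [AddCommGroup X] [Module F X] [AddCommGroup Z] [Module F Z]
    (ρ : L →ₗ⁅F⁆ Module.End F X) (σ : L →ₗ⁅F⁆ Module.End F Z) (f : X →ₗ[F] Z)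
    (h : ∀ x v, f (ρ x v) = σ x (f v)) (u : UniversalEnvelopingAlgebra F L) (v : X) :
    f (lift F ρ u v) = lift F σ u (f v) := by
  induction u using induction generalizing v with
  | algebraMap c => simp [Module.algebraMap_end_apply]
  | ι x => rw [lift_ι_apply, lift_ι_apply, h]
  | mul a b ha hb => rw [map_mul, map_mul, Module.End.mul_apply, Module.End.mul_apply, ha, hb]
  | add a b ha hb => rw [map_add, map_add, LinearMap.add_apply, LinearMap.add_apply, map_add, ha, hb]

/-- A subspace invariant under a Lie algebra is invariant under the enveloping algebra. -/
theorem lift_mem {X : Type*} [AddCommGroup X] [Module F X] (ρ : L →ₗ⁅F⁆ Module.End F X)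
    (N : Submodule F X) (hN : ∀ x, ∀ v ∈ N, ρ x v ∈ N) (u : UniversalEnvelopingAlgebra F L) {v : X}
    (hv : v ∈ N) : lift F ρ u v ∈ N := by
  induction u using induction generalizing v with
  | algebraMap c => simpa [Module.algebraMap_end_apply] using N.smul_mem c hv
  | ι x => rw [lift_ι_apply]; exact hN x v hv
  | mul a b ha hb => rw [map_mul, Module.End.mul_apply]; exact ha (hb hv)
  | add a b ha hb => rw [map_add, LinearMap.add_apply]; exact add_mem (ha hv) (hb hv)

/-- The comultiplication, determined by `x ↦ x ⊗ 1 + 1 ⊗ x` for `x ∈ L`. -/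
def comul : UniversalEnvelopingAlgebra F L →ₐ[F]
    UniversalEnvelopingAlgebra F L ⊗[F] UniversalEnvelopingAlgebra F L :=
  lift F
    { toFun := fun x => ι F x ⊗ₜ 1 + 1 ⊗ₜ ι F x
      map_add' := fun x y => by
        rw [map_add, TensorProduct.add_tmul, TensorProduct.tmul_add]; abel
      map_smul' := fun c x => by
        rw [map_smul, RingHom.id_apply, smul_add, TensorProduct.smul_tmul',
          TensorProduct.tmul_smul]
      map_lie' := fun {x y} => by
        simp only [LieHom.map_lie, Ring.lie_def, mul_add, add_mul,
          Algebra.TensorProduct.tmul_mul_tmul, one_mul, mul_one, TensorProduct.sub_tmul,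
          TensorProduct.tmul_sub]
        abel }

theorem comul_ι (x : L) : comul (ι F x) = ι F x ⊗ₜ[F] 1 + 1 ⊗ₜ[F] ι F x := by
  rw [comul, lift_ι_apply]; rfl

/-- The counit, through which the enveloping algebra acts on the trivial module. -/
def counit : UniversalEnvelopingAlgebra F L →ₐ[F] F := lift F (0 : L →ₗ⁅F⁆ F)

theorem counit_ι (x : L) : counit (ι F x) = (0 : F) := by
  rw [counit, lift_ι_apply]; rfl

theorem lift_tensorRep {V W : Type*} [AddCommGroup V] [Module F V] [AddCommGroup W]
    [Module F W] (ψ : L →ₗ⁅F⁆ Module.End F V) (χ : L →ₗ⁅F⁆ Module.End F W)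
    (u : UniversalEnvelopingAlgebra F L) :
    lift F (tensorRep ψ χ) u = TensorProduct.homTensorHomMap (RingHom.id F) V W V W
      (TensorProduct.map (lift F ψ).toLinearMap (lift F χ).toLinearMap (comul u)) := by
  have h : lift F (tensorRep ψ χ) = (Module.endTensorEndAlgHom (R := F) (S := F) (A := F)).comp
      ((Algebra.TensorProduct.map (lift F ψ) (lift F χ)).comp comul) := by
    ext x : 2
    simp only [LieHom.comp_apply, AlgHom.coe_toLieHom, AlgHom.comp_apply, lift_ι_apply, comul_ι]
    refine TensorProduct.ext' fun v w => ?_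
    simp
    rfl
  have h' : ∀ t : Module.End F V ⊗[F] Module.End F W,
      Module.endTensorEndAlgHom (R := F) (S := F) (A := F) t =
        TensorProduct.homTensorHomMap (RingHom.id F) V W V W t := by
    intro t
    induction t with
    | zero => rw [map_zero, map_zero]
    | add a b ha hb => rw [map_add, map_add, ha, hb]
    | tmul a b => exact TensorProduct.ext' fun v w => rfl
  rw [h]
  exact h' _

theorem lift_prodRep {V W : Type*} [AddCommGroup V] [Module F V] [AddCommGroup W]
    [Module F W] (ψ : L →ₗ⁅F⁆ Module.End F V) (χ : L →ₗ⁅F⁆ Module.End F W)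
    (u : UniversalEnvelopingAlgebra F L) :
    lift F (prodRep ψ χ) u = (lift F ψ u).prodMap (lift F χ u) := by
  refine LinearMap.ext fun v => Prod.ext ?_ ?_
  · exact lift_equivariant (prodRep ψ χ) ψ (LinearMap.fst F V W) (fun _ _ => rfl) u v
  · exact lift_equivariant (prodRep ψ χ) χ (LinearMap.snd F V W) (fun _ _ => rfl) u v

/-- The contraction `(g ⊗ 1) ∘ comul` of the comultiplication with a linear form `g`. -/
def contract (g : UniversalEnvelopingAlgebra F L →ₗ[F] F) :
    UniversalEnvelopingAlgebra F L →ₗ[F] UniversalEnvelopingAlgebra F L :=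
  (TensorProduct.lid F _).toLinearMap ∘ₗ g.rTensor _ ∘ₗ comul.toLinearMap

theorem contract_one (g : UniversalEnvelopingAlgebra F L →ₗ[F] F) :
    contract g 1 = g 1 • 1 := by
  simp [contract, Algebra.TensorProduct.one_def]

theorem contract_ι_mul (g : UniversalEnvelopingAlgebra F L →ₗ[F] F) (x : L)
    (u : UniversalEnvelopingAlgebra F L) :
    contract g (ι F x * u) = contract (g ∘ₗ LinearMap.mulLeft F (ι F x)) u
      + ι F x * contract g u := by
  have h : ∀ t : UniversalEnvelopingAlgebra F L ⊗[F] UniversalEnvelopingAlgebra F L,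
      TensorProduct.lid F _ (g.rTensor _ ((ι F x ⊗ₜ 1 + 1 ⊗ₜ ι F x) * t)) =
        TensorProduct.lid F _ ((g ∘ₗ LinearMap.mulLeft F (ι F x)).rTensor _ t)
          + ι F x * TensorProduct.lid F _ (g.rTensor _ t) := by
    intro t
    induction t with
    | zero => simp
    | add a b ha hb => rw [mul_add, map_add, map_add, ha, hb]; simp only [map_add, mul_add]; abel
    | tmul a b => simp [add_mul]
  simp only [contract, LinearMap.comp_apply, AlgHom.toLinearMap_apply, map_mul, comul_ι,
    LinearEquiv.coe_coe]
  exact h _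

end UniversalEnvelopingAlgebra

/-! ### Maps controlled by a class of modules -/

/-- A class of representations of `L`. -/
abbrev RepClass (F : Type u) [Field F] (L : Type u) [LieRing L] [LieAlgebra F L] : Type (u + 1) :=
  ∀ (Y : Type u) [AddCommGroup Y] [Module F Y], (L →ₗ⁅F⁆ Module.End F Y) → Prop

/-- A class of finite-dimensional representations that contains the trivial one and is closed
under direct sums and tensor products. -/
structure IsTensorClass {F : Type u} [Field F] {L : Type u} [LieRing L] [LieAlgebra F L]
    (𝒞 : RepClass F L) : Prop where
  finite : ∀ (Y : Type u) [AddCommGroup Y] [Module F Y] (ρ : L →ₗ⁅F⁆ Module.End F Y),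
    𝒞 Y ρ → FiniteDimensional F Y
  trivial : 𝒞 F 0
  prod : ∀ (Y Z : Type u) [AddCommGroup Y] [Module F Y] [AddCommGroup Z] [Module F Z]
    (ρ : L →ₗ⁅F⁆ Module.End F Y) (σ : L →ₗ⁅F⁆ Module.End F Z), 𝒞 Y ρ → 𝒞 Z σ →
      𝒞 (Y × Z) (prodRep ρ σ)
  tensor : ∀ (Y Z : Type u) [AddCommGroup Y] [Module F Y] [AddCommGroup Z] [Module F Z]
    (ρ : L →ₗ⁅F⁆ Module.End F Y) (σ : L →ₗ⁅F⁆ Module.End F Z), 𝒞 Y ρ → 𝒞 Z σ →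
      𝒞 (Y ⊗[F] Z) (tensorRep ρ σ)

/-- A linear map on the enveloping algebra is dominated by a class of representations if it
vanishes on the annihilator of some member of the class. -/
def Dominated {F : Type u} [Field F] {L : Type u} [LieRing L] [LieAlgebra F L]
    (𝒞 : RepClass F L) {A : Type*} [AddCommGroup A] [Module F A]
    (α : UniversalEnvelopingAlgebra F L →ₗ[F] A) : Prop :=
  ∃ (Y : Type u) (_ : AddCommGroup Y) (_ : Module F Y) (ρ : L →ₗ⁅F⁆ Module.End F Y),
    𝒞 Y ρ ∧ ∀ u, UniversalEnvelopingAlgebra.lift F ρ u = 0 → α u = 0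

namespace Dominated

open UniversalEnvelopingAlgebra

variable {F : Type u} [Field F] {L : Type u} [LieRing L] [LieAlgebra F L]
  {𝒞 : RepClass F L} {A B : Type*} [AddCommGroup A] [Module F A] [AddCommGroup B] [Module F B]
  {α : UniversalEnvelopingAlgebra F L →ₗ[F] A} {β : UniversalEnvelopingAlgebra F L →ₗ[F] B}

theorem of_ker_le (hα : Dominated 𝒞 α) (h : ∀ u, α u = 0 → β u = 0) : Dominated 𝒞 β := by
  obtain ⟨Y, _, _, ρ, hρ, hY⟩ := hα
  exact ⟨Y, _, _, ρ, hρ, fun u hu => h u (hY u hu)⟩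

theorem of_rep {Y : Type u} [AddCommGroup Y] [Module F Y] (ρ : L →ₗ⁅F⁆ Module.End F Y)
    (h : 𝒞 Y ρ) : Dominated 𝒞 (lift F ρ).toLinearMap :=
  ⟨Y, _, _, ρ, h, fun _ hu => hu⟩

variable (h𝒞 : IsTensorClass 𝒞)
include h𝒞

theorem prod (hα : Dominated 𝒞 α) (hβ : Dominated 𝒞 β) : Dominated 𝒞 (α.prod β) := by
  obtain ⟨Y, _, _, ρ, hρ, hY⟩ := hα
  obtain ⟨Z, _, _, σ, hσ, hZ⟩ := hβ
  refine ⟨Y × Z, _, _, prodRep ρ σ, h𝒞.prod Y Z ρ σ hρ hσ, fun u hu => ?_⟩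
  rw [lift_prodRep] at hu
  refine Prod.ext (hY u (LinearMap.ext fun y => ?_)) (hZ u (LinearMap.ext fun z => ?_))
  · simpa using congrArg Prod.fst (LinearMap.congr_fun hu (y, 0))
  · simpa using congrArg Prod.snd (LinearMap.congr_fun hu (0, z))

/-- The annihilator of a tensor product is detected on the tensor product of the images. -/
theorem tensor (hα : Dominated 𝒞 α) (hβ : Dominated 𝒞 β) :
    Dominated 𝒞 (TensorProduct.map α β ∘ₗ comul.toLinearMap) := by
  obtain ⟨Y, _, _, ρ, hρ, hY⟩ := hα
  obtain ⟨Z, _, _, σ, hσ, hZ⟩ := hβ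
  have := h𝒞.finite Y ρ hρ
  have := h𝒞.finite Z σ hσ
  refine ⟨Y ⊗[F] Z, _, _, tensorRep ρ σ, h𝒞.tensor Y Z ρ σ hρ hσ, fun u hu => ?_⟩
  rw [lift_tensorRep, ← homTensorHomEquiv_toLinearMap, LinearEquiv.coe_coe,
    LinearEquiv.map_eq_zero_iff] at hu
  obtain ⟨a, ha⟩ := LinearMap.exists_comp_eq_of_ker_le (lift F ρ).toLinearMap α hY
  obtain ⟨b, hb⟩ := LinearMap.exists_comp_eq_of_ker_le (lift F σ).toLinearMap β hZ
  have h1 : α = a ∘ₗ (lift F ρ).toLinearMap := LinearMap.ext fun u => (ha u).symm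
  have h2 : β = b ∘ₗ (lift F σ).toLinearMap := LinearMap.ext fun u => (hb u).symm
  rw [h1, h2, TensorProduct.map_comp, LinearMap.comp_apply, LinearMap.comp_apply,
    AlgHom.toLinearMap_apply, hu, map_zero]

theorem comp_contract {g : UniversalEnvelopingAlgebra F L →ₗ[F] F} (hα : Dominated 𝒞 α)
    (hg : Dominated 𝒞 g) : Dominated 𝒞 (α ∘ₗ contract g) := by
  refine (tensor h𝒞 hg hα).of_ker_le fun u hu => ?_
  have h : ∀ t : UniversalEnvelopingAlgebra F L ⊗[F] UniversalEnvelopingAlgebra F L,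
      α (TensorProduct.lid F _ (g.rTensor _ t)) =
        TensorProduct.lid F _ (TensorProduct.map g α t) := by
    intro t
    induction t with
    | zero => simp
    | add a b ha hb => simp only [map_add, ha, hb]
    | tmul a b => simp
  refine (h _).trans ?_
  rw [LinearMap.comp_apply] at hu
  rw [hu, map_zero]

theorem counit : Dominated 𝒞 (counit (F := F) (L := L)).toLinearMap := by
  refine (of_rep _ h𝒞.trivial).of_ker_le fun u hu => ?_
  have h : lift F (0 : L →ₗ⁅F⁆ Module.End F F) =
      (Algebra.ofId F (Module.End F F)).comp UniversalEnvelopingAlgebra.counit := by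
    ext x : 2
    simp only [LieHom.comp_apply, AlgHom.coe_toLieHom, AlgHom.comp_apply, lift_ι_apply, counit_ι,
      map_zero]
    rfl
  rw [h] at hu
  simpa [Algebra.ofId_apply, Module.algebraMap_end_apply] using
    LinearMap.congr_fun (show Algebra.ofId F (Module.End F F)
      (UniversalEnvelopingAlgebra.counit u) = 0 from hu) 1

/-- Finitely many dominated maps are dominated by a single representation. -/
theorem exists_rep {κ : Type*} (s : Set κ) (hs : s.Finite)
    (γ : κ → UniversalEnvelopingAlgebra F L →ₗ[F] A) (hγ : ∀ k ∈ s, Dominated 𝒞 (γ k)) :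
    ∃ (Y : Type u) (_ : AddCommGroup Y) (_ : Module F Y) (ρ : L →ₗ⁅F⁆ Module.End F Y),
      𝒞 Y ρ ∧ ∀ k ∈ s, ∀ u, lift F ρ u = 0 → γ k u = 0 := by
  induction s, hs using Set.Finite.induction_on with
  | empty => exact ⟨F, _, _, 0, h𝒞.trivial, by simp⟩
  | @insert k s _ _ ih =>
    obtain ⟨Y, _, _, ρ, hρ, hY⟩ := ih fun j hj => hγ j (Set.mem_insert_of_mem _ hj)
    obtain ⟨Z, _, _, σ, hσ, hZ⟩ := prod h𝒞 (of_rep ρ hρ) (hγ k (Set.mem_insert _ _))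
    refine ⟨Z, _, _, σ, hσ, fun j hj u hu => ?_⟩
    have h := hZ u hu
    rcases hj with rfl | hj
    · exact congrArg Prod.snd h
    · exact hY j hj u (congrArg Prod.fst h)

end Dominated

/-! ### Words in the enveloping algebra -/

namespace UniversalEnvelopingAlgebra

variable {F L κ : Type*} [Field F] [LieRing L] [LieAlgebra F L] (e : κ → L)

/-- The product in the enveloping algebra of a list of elements of a family. -/
def word (l : List κ) : UniversalEnvelopingAlgebra F L := (l.map fun j => ι F (e j)).prod

@[simp] theorem word_nil : word (F := F) e [] = 1 := rfl

theorem word_cons (j : κ) (l : List κ) : word (F := F) e (j :: l) = ι F (e j) * word e l :=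
  List.prod_cons

theorem word_append (l l' : List κ) : word (F := F) e (l ++ l') = word e l * word e l' := by
  simp [word]

/-- The span of the words of length less than `n`. -/
def shortWords (n : ℕ) : Submodule F (UniversalEnvelopingAlgebra F L) :=
  Submodule.span F (word e '' {l | l.length < n})

variable {e}

theorem word_mem_shortWords {l : List κ} {n : ℕ} (h : l.length < n) :
    word (F := F) e l ∈ shortWords e n :=
  Submodule.subset_span ⟨l, h, rfl⟩

theorem shortWords_mono {m n : ℕ} (h : m ≤ n) : shortWords (F := F) e m ≤ shortWords e n :=
  Submodule.span_mono (Set.image_mono fun _ hl => lt_of_lt_of_le hl h)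

theorem shortWords_zero : shortWords (F := F) e 0 = ⊥ := by
  simp [shortWords]

theorem ι_mul_mem_shortWords {u : UniversalEnvelopingAlgebra F L} {n : ℕ}
    (hu : u ∈ shortWords e n) (j : κ) : ι F (e j) * u ∈ shortWords e (n + 1) := by
  induction hu using Submodule.span_induction with
  | mem x hx =>
    obtain ⟨l, hl, rfl⟩ := hx
    rw [← word_cons]
    exact word_mem_shortWords (by simpa using hl)
  | zero => rw [mul_zero]; exact zero_mem _
  | add x y _ _ hx hy => rw [mul_add]; exact add_mem hx hy
  | smul c x _ hx => rw [mul_smul_comm]; exact Submodule.smul_mem _ c hx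

/-! ### Reduction to restricted words -/

section Reduction

variable {A : Type*} [Ring A] [Algebra F A] (σ : UniversalEnvelopingAlgebra F L →ₐ[F] A)

theorem mul_word_mem_of_span
    (hspan : ∀ x, σ (ι F x) ∈ Submodule.span F (Set.range fun j => σ (ι F (e j)))) (x : L)
    (l : List κ) : σ (ι F x) * σ (word e l) ∈ (shortWords e (l.length + 2)).map σ.toLinearMap := by
  have h := hspan x
  generalize σ (ι F x) = y at h ⊢
  induction h using Submodule.span_induction with
  | mem y hy =>
    obtain ⟨j, rfl⟩ := hy
    refine ⟨word e (j :: l), word_mem_shortWords (by simp), ?_⟩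
    rw [word_cons]
    exact map_mul σ _ _
  | zero => rw [zero_mul]; exact zero_mem _
  | add x y _ _ hx hy => rw [add_mul]; exact add_mem hx hy
  | smul c x _ hx => rw [smul_mul_assoc]; exact Submodule.smul_mem _ c hx

/-- Permuting a word changes it by shorter words. -/
theorem sub_mem_of_perm
    (hspan : ∀ x, σ (ι F x) ∈ Submodule.span F (Set.range fun j => σ (ι F (e j))))
    {l l' : List κ} (h : l.Perm l') :
    σ (word e l) - σ (word e l') ∈ (shortWords e l.length).map σ.toLinearMap := by
  induction h with
  | nil => rw [sub_self]; exact zero_mem _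
  | cons j _ ih =>
    obtain ⟨u, hu, huv⟩ := ih
    refine ⟨ι F (e j) * u, ι_mul_mem_shortWords hu j, ?_⟩
    rw [AlgHom.toLinearMap_apply] at huv
    rw [word_cons, word_cons, AlgHom.toLinearMap_apply, map_mul, map_mul, map_mul, huv, mul_sub]
  | swap i j l =>
    have h := mul_word_mem_of_span σ hspan ⁅e j, e i⁆ l
    rw [LieHom.map_lie, Ring.lie_def, map_sub, map_mul, map_mul, sub_mul, mul_assoc, mul_assoc] at h
    simp only [word_cons, map_mul]
    exact h
  | trans h₁ _ ih₁ ih₂ =>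
    rw [← h₁.length_eq] at ih₂
    simpa using add_mem ih₁ ih₂

/-- If `σ x ^ p` is again in the span of the `σ (e j)`, then every word is under `σ` a combination
of words in which no letter occurs `p` times; one word is chosen for each multiset of letters. -/
theorem word_mem_span_restricted [DecidableEq κ] {p : ℕ} (hp : 2 ≤ p)
    (hspan : ∀ x, σ (ι F x) ∈ Submodule.span F (Set.range fun j => σ (ι F (e j))))
    (hpow : ∀ x, ∃ y, σ (ι F x) ^ p = σ (ι F y)) (l : List κ) :
    σ (word e l) ∈ (Submodule.span F
      ((fun m : Multiset κ => word e m.toList) '' {m | ∀ i, m.count i < p})).map σ.toLinearMap := by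
  induction hn : l.length using Nat.strong_induction_on generalizing l with
  | _ n ih =>
  have hshort : (shortWords e n).map σ.toLinearMap ≤ (Submodule.span F
      ((fun m : Multiset κ => word e m.toList) '' {m | ∀ i, m.count i < p})).map
        σ.toLinearMap := by
    rw [shortWords, Submodule.map_span, Submodule.span_le]
    rintro _ ⟨_, ⟨l', hl', rfl⟩, rfl⟩
    exact ih _ hl' l' rfl
  by_cases hl : ∀ i, (l : Multiset κ).count i < p
  · have hperm : l.Perm (l : Multiset κ).toList :=
      Multiset.coe_eq_coe.1 (Multiset.coe_toList _).symm
    have h := sub_mem_of_perm σ hspan hperm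
    rw [hn] at h
    have h2 : σ (word e (l : Multiset κ).toList) ∈ (Submodule.span F
        ((fun m : Multiset κ => word e m.toList) '' {m | ∀ i, m.count i < p})).map
          σ.toLinearMap :=
      ⟨_, Submodule.subset_span ⟨(l : Multiset κ), hl, rfl⟩, rfl⟩
    simpa using add_mem (hshort h) h2
  · push Not at hl
    obtain ⟨i, hi⟩ := hl
    rw [Multiset.coe_count] at hi
    have hle : Multiset.replicate p i ≤ (l : Multiset κ) :=
      Multiset.le_count_iff_replicate_le.1 (by rwa [Multiset.coe_count])
    obtain ⟨m, hm⟩ := Multiset.le_iff_exists_add.1 hle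
    have hperm : l.Perm (List.replicate p i ++ m.toList) := by
      rw [← Multiset.coe_eq_coe, hm, ← Multiset.coe_add, Multiset.coe_toList,
        Multiset.coe_replicate]
    have hlen : l.length = p + m.toList.length := by
      rw [hperm.length_eq, List.length_append, List.length_replicate]
    have h := sub_mem_of_perm σ hspan hperm
    rw [hn] at h
    obtain ⟨y, hy⟩ := hpow (e i)
    have h2 : σ (word e (List.replicate p i ++ m.toList)) = σ (ι F y) * σ (word e m.toList) := by
      rw [word_append, map_mul, ← hy]
      congr 1
      simp [word]
    have h3 := mul_word_mem_of_span σ hspan y m.toList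
    rw [← h2] at h3
    have h4 : (shortWords e (m.toList.length + 2)).map σ.toLinearMap ≤
        (shortWords e n).map σ.toLinearMap :=
      Submodule.map_mono (shortWords_mono (by omega))
    simpa using add_mem (hshort h) (hshort (h4 h3))

theorem exists_restricted [DecidableEq κ] {p : ℕ} (hp : 2 ≤ p)
    (hspan : ∀ x, σ (ι F x) ∈ Submodule.span F (Set.range fun j => σ (ι F (e j))))
    (hpow : ∀ x, ∃ y, σ (ι F x) ^ p = σ (ι F y)) (u : UniversalEnvelopingAlgebra F L) :
    ∃ v ∈ Submodule.span F
      ((fun m : Multiset κ => word e m.toList) '' {m | ∀ i, m.count i < p}), σ v = σ u := by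
  let P : Submodule F A := Submodule.span F (Set.range fun l : List κ => σ (word e l))
  have hP : P ≤ (Submodule.span F
      ((fun m : Multiset κ => word e m.toList) '' {m | ∀ i, m.count i < p})).map
        σ.toLinearMap := by
    rw [Submodule.span_le]
    rintro _ ⟨l, rfl⟩
    exact word_mem_span_restricted σ hp hspan hpow l
  have hPn : ∀ n, (shortWords e n).map σ.toLinearMap ≤ P := by
    intro n
    rw [shortWords, Submodule.map_span, Submodule.span_le]
    rintro _ ⟨_, ⟨l, -, rfl⟩, rfl⟩
    exact Submodule.subset_span ⟨l, rfl⟩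
  have hmul : ∀ t ∈ P, σ u * t ∈ P := by
    induction u using induction with
    | algebraMap c =>
      intro t ht
      rw [AlgHom.commutes, ← Algebra.smul_def]
      exact P.smul_mem c ht
    | ι x =>
      intro t ht
      induction ht using Submodule.span_induction with
      | mem t ht =>
        obtain ⟨l, rfl⟩ := ht
        exact hPn _ (mul_word_mem_of_span σ hspan x l)
      | zero => rw [mul_zero]; exact zero_mem _
      | add x y _ _ hx hy => rw [mul_add]; exact add_mem hx hy
      | smul c x _ hx => rw [mul_smul_comm]; exact P.smul_mem c hx
    | mul a b ha hb => exact fun t ht => by rw [map_mul, mul_assoc]; exact ha _ (hb t ht)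
    | add a b ha hb => exact fun t ht => by rw [map_add, add_mul]; exact add_mem (ha t ht) (hb t ht)
  have h1 : σ u * 1 ∈ P := hmul 1 (Submodule.subset_span ⟨[], by simp⟩)
  rw [mul_one] at h1
  obtain ⟨v, hv, hvu⟩ := hP h1
  exact ⟨v, hv, hvu⟩

end Reduction

/-! ### Contractions of words -/

section Contraction

theorem contract_word_sub_mem (g : UniversalEnvelopingAlgebra F L →ₗ[F] F) (l : List κ) :
    contract g (word e l) - g 1 • word e l ∈ shortWords e l.length := by
  induction l generalizing g with
  | nil => rw [word_nil, contract_one, sub_self]; exact zero_mem _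
  | cons j l ih =>
    rw [word_cons, contract_ι_mul]
    have h1 := ih (g ∘ₗ LinearMap.mulLeft F (ι F (e j)))
    have h2 := ι_mul_mem_shortWords (ih g) j
    have h3 : contract (g ∘ₗ LinearMap.mulLeft F (ι F (e j))) (word e l) ∈
        shortWords e (l.length + 1) := by
      have h4 : (g ∘ₗ LinearMap.mulLeft F (ι F (e j))) 1 • word e l ∈
          shortWords e (l.length + 1) :=
        Submodule.smul_mem _ _ (word_mem_shortWords (Nat.lt_succ_self _))
      simpa using add_mem (shortWords_mono (Nat.le_succ _) h1) h4
    have h5 := add_mem h3 h2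
    rw [mul_sub, mul_smul_comm] at h5
    rw [List.length_cons, add_sub_assoc]
    exact h5

variable [DecidableEq κ]

variable (F e) in
/-- The sum of the words obtained from a word by deleting one occurrence of a given letter. -/
def deleteOne (i : κ) : List κ → UniversalEnvelopingAlgebra F L
  | [] => 0
  | j :: l => (if j = i then word e l else 0) + ι F (e j) * deleteOne i l

/-- If the linear form `g` is dual to the letter `i`, contraction with `g` is to leading order the
partial derivative with respect to `i`. -/
theorem contract_word_sub_deleteOne_mem (g : UniversalEnvelopingAlgebra F L →ₗ[F] F) (i : κ)
    (hg1 : g 1 = 0) (hg : ∀ j, g (ι F (e j)) = if j = i then 1 else 0) (l : List κ) :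
    contract g (word e l) - deleteOne F e i l ∈ shortWords e (l.length - 1) := by
  induction l with
  | nil => rw [word_nil, contract_one, hg1, zero_smul, deleteOne, sub_self]; exact zero_mem _
  | cons j l ih =>
    rw [word_cons, contract_ι_mul, deleteOne, List.length_cons, Nat.add_sub_cancel]
    have h1 := contract_word_sub_mem (e := e) (g ∘ₗ LinearMap.mulLeft F (ι F (e j))) l
    have h2 : ι F (e j) * (contract g (word e l) - deleteOne F e i l) ∈ shortWords e l.length := by
      rcases Nat.eq_zero_or_pos l.length with h | h
      · rw [h, Nat.zero_sub, shortWords_zero, Submodule.mem_bot] at ih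
        rw [ih, mul_zero]
        exact zero_mem _
      · have := ι_mul_mem_shortWords ih j
        rwa [Nat.sub_add_cancel h] at this
    have h3 : (g ∘ₗ LinearMap.mulLeft F (ι F (e j))) 1 • word (F := F) e l =
        if j = i then word (F := F) e l else 0 := by
      rw [LinearMap.comp_apply, LinearMap.mulLeft_apply, mul_one, hg, ite_smul, one_smul, zero_smul]
    rw [h3] at h1
    have h4 := add_mem h1 h2
    rw [mul_sub] at h4
    convert h4 using 1
    abel

theorem deleteOne_mem (i : κ) (l : List κ) :
    deleteOne F e i l ∈ shortWords (F := F) e l.length := by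
  induction l with
  | nil => exact zero_mem _
  | cons j l ih =>
    refine add_mem ?_ (ι_mul_mem_shortWords ih j)
    split_ifs
    · exact word_mem_shortWords (Nat.lt_succ_self _)
    · exact zero_mem _

theorem apply_mul_deleteOne (h : UniversalEnvelopingAlgebra F L →ₗ[F] F) (i : κ) (l' : List κ)
    (c : F) (hc : ∀ l : List κ, l.length = l'.length → h (word e l) = if l.Perm l' then c else 0)
    (l₀ l : List κ) (hl : (l₀ ++ l).length = l'.length + 1) :
    h (word e l₀ * deleteOne F e i l) =
      if (l₀ ++ l).Perm (i :: l') then (l.count i : F) * c else 0 := by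
  induction l generalizing l₀ with
  | nil => simp [deleteOne]
  | cons j l ih =>
    have h1 := ih (l₀ ++ [j]) (by simpa using hl)
    rw [word_append, mul_assoc, word_cons, word_nil, mul_one, List.append_assoc,
      List.singleton_append] at h1
    rw [deleteOne, mul_add, map_add, h1]
    by_cases hj : j = i
    · subst hj
      rw [if_pos rfl, ← word_append, hc _ (by simp at hl ⊢; omega)]
      have h2 : (l₀ ++ j :: l).Perm (j :: l') ↔ (l₀ ++ l).Perm l' := by
        rw [List.perm_middle.congr_left, List.perm_cons]
      simp only [h2, List.count_cons_self]
      split_ifs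
      · push_cast; ring
      · ring
    · rw [if_neg hj, mul_zero, map_zero, zero_add, List.count_cons_of_ne hj]

/-- The iterated contraction with the forms given by a list, followed by the counit. -/
def iteratedForm (g : κ → UniversalEnvelopingAlgebra F L →ₗ[F] F) :
    List κ → UniversalEnvelopingAlgebra F L →ₗ[F] F
  | [] => counit.toLinearMap
  | i :: l => iteratedForm g l ∘ₗ contract (g i)

variable (g : κ → UniversalEnvelopingAlgebra F L →ₗ[F] F) (hg1 : ∀ i, g i 1 = 0)
  (hg : ∀ i j, g i (ι F (e j)) = if j = i then 1 else 0)
include hg1 hg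

theorem iteratedForm_eq_zero (l' : List κ) (u : UniversalEnvelopingAlgebra F L)
    (hu : u ∈ shortWords e l'.length) : iteratedForm g l' u = 0 := by
  induction l' generalizing u with
  | nil =>
    rw [List.length_nil, shortWords_zero, Submodule.mem_bot] at hu
    rw [hu, map_zero]
  | cons i l' ih =>
    refine ih _ ?_
    induction hu using Submodule.span_induction with
    | mem y hy =>
      obtain ⟨l, hl, rfl⟩ := hy
      have h1 := contract_word_sub_deleteOne_mem (g i) i (hg1 i) (hg i) l
      have h2 := add_mem (shortWords_mono (Nat.sub_le _ 1) h1) (deleteOne_mem i l)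
      rw [sub_add_cancel] at h2
      exact shortWords_mono (Nat.le_of_lt_succ hl) h2
    | zero => rw [map_zero]; exact zero_mem _
    | add x y _ _ hx hy => rw [map_add]; exact add_mem hx hy
    | smul c x _ hx => rw [map_smul]; exact Submodule.smul_mem _ c hx

/-- The iterated contraction along `l'` detects, among the words of the same length, those that
are permutations of `l'`, with a product of factorials of multiplicities as coefficient. -/
theorem exists_iteratedForm_word {p : ℕ} [Fact p.Prime] [CharP F p] (l' : List κ)
    (hl' : ∀ i, l'.count i < p) : ∃ c : F, c ≠ 0 ∧ ∀ l : List κ, l.length = l'.length →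
      iteratedForm g l' (word e l) = if l.Perm l' then c else 0 := by
  induction l' with
  | nil =>
    refine ⟨1, one_ne_zero, fun l hl => ?_⟩
    rw [List.length_nil, List.length_eq_zero_iff] at hl
    subst hl
    rw [if_pos (List.Perm.refl _), word_nil]
    exact map_one counit
  | cons i l' ih =>
    obtain ⟨c, hc0, hc⟩ := ih fun j =>
      lt_of_le_of_lt ((List.sublist_cons_self i l').count_le j) (hl' j)
    refine ⟨((i :: l').count i : F) * c, mul_ne_zero ?_ hc0, fun l hl => ?_⟩
    · rw [Ne, CharP.cast_eq_zero_iff F p]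
      exact Nat.not_dvd_of_pos_of_lt (by simp) (hl' i)
    · have h1 := contract_word_sub_deleteOne_mem (g i) i (hg1 i) (hg i) l
      have h2 := iteratedForm_eq_zero (e := e) g hg1 hg l' _
        (shortWords_mono (by rw [hl, List.length_cons, Nat.add_sub_cancel]) h1)
      rw [map_sub, sub_eq_zero] at h2
      have h3 := apply_mul_deleteOne (e := e) (iteratedForm g l') i l' c hc [] l (by simpa using hl)
      rw [word_nil, one_mul, List.nil_append] at h3
      refine h2.trans (h3.trans ?_)
      split_ifs with h
      · rw [h.count_eq]
      · rfl

/-- A combination of restricted words killed by all iterated contractions is zero: contract along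
a word of maximal length in it. -/
theorem eq_zero_of_iteratedForm {p : ℕ} [Fact p.Prime] [CharP F p]
    (v : UniversalEnvelopingAlgebra F L) (hv : v ∈ Submodule.span F
      ((fun m : Multiset κ => word e m.toList) '' {m | ∀ i, m.count i < p}))
    (h : ∀ m : Multiset κ, (∀ i, m.count i < p) → iteratedForm g m.toList v = 0) : v = 0 := by
  obtain ⟨a, ha, rfl⟩ := (Finsupp.mem_span_image_iff_linearCombination F).1 hv
  by_cases ha0 : a = 0
  · rw [ha0, map_zero]
  obtain ⟨m, hm, hmax⟩ := a.support.exists_max_image Multiset.card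
    (Finsupp.support_nonempty_iff.2 ha0)
  have hmr : ∀ i, m.count i < p := (Finsupp.mem_supported F a).1 ha hm
  obtain ⟨c, hc0, hc⟩ := exists_iteratedForm_word (e := e) (p := p) g hg1 hg m.toList (fun i => by
    rw [← Multiset.coe_count, Multiset.coe_toList]; exact hmr i)
  have h1 := h m hmr
  rw [Finsupp.linearCombination_apply, Finsupp.sum, map_sum,
    Finset.sum_eq_single_of_mem m hm] at h1
  · rw [map_smul, hc _ rfl, if_pos (List.Perm.refl _), smul_eq_mul] at h1
    exact absurd h1 (mul_ne_zero (Finsupp.mem_support_iff.1 hm) hc0)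
  · intro m' hm' hne
    rw [map_smul]
    have hle := hmax m' hm'
    rcases hle.lt_or_eq with hlt | heq
    · rw [iteratedForm_eq_zero (e := e) g hg1 hg _ _ (word_mem_shortWords (by simpa using hlt)),
        smul_zero]
    · rw [hc _ (by simpa using heq), if_neg, smul_zero]
      intro hp
      refine hne ?_
      rw [← Multiset.coe_toList m', ← Multiset.coe_toList m]
      exact Multiset.coe_eq_coe.2 hp

end Contraction

end UniversalEnvelopingAlgebra

/-! ### Restricted representations -/

theorem Commute.add_pow_prime_of_algebra (F : Type*) [Field F] (p : ℕ) [Fact p.Prime] [CharP F p]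
    {A : Type*} [Ring A] [Algebra F A] {a b : A} (h : Commute a b) :
    (a + b) ^ p = a ^ p + b ^ p := by
  cases subsingleton_or_nontrivial A
  · exact Subsingleton.elim _ _
  · have : CharP A p := charP_of_injective_algebraMap (algebraMap F A).injective p
    exact add_pow_expChar_of_commute p h

theorem Commute.sub_pow_prime_of_algebra (F : Type*) [Field F] (p : ℕ) [Fact p.Prime] [CharP F p]
    {A : Type*} [Ring A] [Algebra F A] {a b : A} (h : Commute a b) :
    (a - b) ^ p = a ^ p - b ^ p := by
  cases subsingleton_or_nontrivial A
  · exact Subsingleton.elim _ _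
  · have : CharP A p := charP_of_injective_algebraMap (algebraMap F A).injective p
    exact sub_pow_expChar_of_commute p h

/-- A representation `σ` of a restricted Lie algebra with `σ(x)^p = σ(x^{[p]})` that vanishes on
the centre, in an associative algebra. -/
structure IsCentralRestricted {F L A : Type*} [Field F] [LieRing L] [LieAlgebra F L] [Ring A]
    [Algebra F A] (p : ℕ) (pow : L → L) (σ : L →ₗ⁅F⁆ A) : Prop where
  map_pow : ∀ x, σ x ^ p = σ (pow x)
  map_center : ∀ z ∈ LieAlgebra.center F L, σ z = 0

variable {F : Type u} [Field F] {L : Type u} [LieRing L] [LieAlgebra F L]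

theorem LieAlgebra.mem_center_iff_ad_eq_zero {z : L} :
    z ∈ LieAlgebra.center F L ↔ LieAlgebra.ad F L z = 0 := by
  rw [← LieAlgebra.self_module_ker_eq_center, ← LieAlgebra.ad_ker_eq_self_module_ker,
    LieHom.mem_ker]

theorem IsPOperation.isCentralRestricted_ad {p : ℕ} {pow : L → L} (hpow : IsPOperation F p pow) :
    IsCentralRestricted p pow (LieAlgebra.ad F L) where
  map_pow x := (hpow.ad_pow x).symm
  map_center _ hz := LieAlgebra.mem_center_iff_ad_eq_zero.1 hz

/-- The restricted members of a tensor class that vanish on the centre form a tensor class. -/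
theorem IsTensorClass.restricted {𝒞 : RepClass F L} (h𝒞 : IsTensorClass 𝒞) (p : ℕ)
    [Fact p.Prime] [CharP F p] (pow : L → L) :
    IsTensorClass (fun Y _ _ ρ => 𝒞 Y ρ ∧ IsCentralRestricted p pow ρ : RepClass F L) where
  finite Y _ _ ρ h := h𝒞.finite Y ρ h.1
  trivial := ⟨h𝒞.trivial, fun _ => zero_pow (Fact.out : p.Prime).ne_zero, fun _ _ => rfl⟩
  prod Y Z _ _ _ _ ρ σ hρ hσ := by
    refine ⟨h𝒞.prod Y Z ρ σ hρ.1 hσ.1, fun x => ?_, fun z hz => ?_⟩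
    · change (ρ x).prodMap (σ x) ^ p = (ρ (pow x)).prodMap (σ (pow x))
      rw [← hρ.2.map_pow, ← hσ.2.map_pow]
      exact (map_pow (LinearMap.prodMapRingHom F Y Z) (ρ x, σ x) p).symm
    · change (ρ z).prodMap (σ z) = 0
      rw [hρ.2.map_center z hz, hσ.2.map_center z hz]
      exact LinearMap.prodMap_zero
  tensor Y Z _ _ _ _ ρ σ hρ hσ := by
    refine ⟨h𝒞.tensor Y Z ρ σ hρ.1 hσ.1, fun x => ?_, fun z hz => ?_⟩
    · change ((ρ x).rTensor Z + (σ x).lTensor Y) ^ p =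
        (ρ (pow x)).rTensor Z + (σ (pow x)).lTensor Y
      rw [Commute.add_pow_prime_of_algebra F p, LinearMap.rTensor_pow, LinearMap.lTensor_pow,
        hρ.2.map_pow, hσ.2.map_pow]
      exact (LinearMap.rTensor_comp_lTensor (M := Y) (N := Z) (ρ x) (σ x)).trans
        (LinearMap.lTensor_comp_rTensor (M := Y) (N := Z) (ρ x) (σ x)).symm
    · change (ρ z).rTensor Z + (σ z).lTensor Y = 0
      rw [hρ.2.map_center z hz, hσ.2.map_center z hz, LinearMap.rTensor_zero,
        LinearMap.lTensor_zero, add_zero]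

open UniversalEnvelopingAlgebra in
/-- A tensor class containing the adjoint representation dominates every representation `σ` as
above. If `e` is a basis of a complement of the centre, the restricted words in `e` span the image
of the enveloping algebra under `σ`, and they are linearly independent on a suitable sum of tensor
powers of the adjoint module. -/
theorem dominated_of_isCentralRestricted [FiniteDimensional F L] {𝒞 : RepClass F L}
    (h𝒞 : IsTensorClass 𝒞) {p : ℕ} [Fact p.Prime] [CharP F p] {pow : L → L}
    (hpow : IsPOperation F p pow) (had : 𝒞 L (LieAlgebra.ad F L)) {A : Type*} [Ring A]
    [Algebra F A] (σ : L →ₗ⁅F⁆ A) (hσ : IsCentralRestricted p pow σ) :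
    Dominated 𝒞 (lift F σ).toLinearMap := by
  let 𝒟 : RepClass F L := fun Y _ _ ρ => 𝒞 Y ρ ∧ IsCentralRestricted p pow ρ
  have h𝒟 : IsTensorClass 𝒟 := h𝒞.restricted p pow
  have had𝒟 : 𝒟 L (LieAlgebra.ad F L) := ⟨had, hpow.isCentralRestricted_ad⟩
  let ad' : L →ₗ[F] Module.End F L := (LieAlgebra.ad F L : L →ₗ[F] Module.End F L)
  let b := Module.finBasis F (LinearMap.range ad')
  let κ := Fin (Module.finrank F (LinearMap.range ad'))
  choose e he using fun j : κ => (b j).2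
  -- every element is a combination of the `e j`, up to a central element
  have hspan : ∀ {B : Type _} [Ring B] [Algebra F B] (τ : L →ₗ⁅F⁆ B),
      IsCentralRestricted p pow τ → ∀ x, τ x ∈ Submodule.span F (Set.range fun j => τ (e j)) := by
    intro B _ _ τ hτ x
    let y : L := ∑ j, b.repr ⟨ad' x, x, rfl⟩ j • e j
    have hy : ad' y = ad' x := by
      have h1 := congrArg Subtype.val (b.sum_repr ⟨ad' x, x, rfl⟩)
      rw [Submodule.coe_sum] at h1
      rw [map_sum]
      refine Eq.trans (Finset.sum_congr rfl fun j _ => ?_) h1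
      rw [map_smul, he j]
      rfl
    have hz : x - y ∈ LieAlgebra.center F L := by
      rw [LieAlgebra.mem_center_iff_ad_eq_zero]
      change ad' (x - y) = 0
      rw [map_sub, hy, sub_self]
    have h2 := hτ.map_center _ hz
    rw [map_sub, sub_eq_zero] at h2
    rw [h2, show τ y = ∑ j, b.repr ⟨ad' x, x, rfl⟩ j • τ (e j) by simp [y]]
    exact Submodule.sum_mem _ fun j _ => Submodule.smul_mem _ _ (Submodule.subset_span ⟨j, rfl⟩)
  -- linear forms dual to the `e j` that vanish at `1`
  choose f hf using fun i : κ => LinearMap.exists_extend (b.coord i)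
  let g : κ → UniversalEnvelopingAlgebra F L →ₗ[F] F := fun i =>
    f i ∘ₗ (lift F (LieAlgebra.ad F L)).toLinearMap - f i 1 • counit.toLinearMap
  have hg1 : ∀ i, g i 1 = 0 := fun i => by
    simp [g]
  have hg : ∀ i j, g i (ι F (e j)) = if j = i then 1 else 0 := fun i j => by
    have h1 : f i (ad' (e j)) = b.coord i (b j) := by
      rw [he j]
      exact LinearMap.congr_fun (hf i) (b j)
    have h2 : g i (ι F (e j)) = f i (ad' (e j)) := by
      simp only [g, LinearMap.sub_apply, LinearMap.comp_apply, LinearMap.smul_apply,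
        AlgHom.toLinearMap_apply, lift_ι_apply, counit_ι, smul_zero, sub_zero]
      rfl
    rw [h2, h1, Module.Basis.coord_apply, b.repr_self, Finsupp.single_apply]
  have hgd : ∀ i, Dominated 𝒟 (g i) := fun i =>
    (Dominated.prod h𝒟 (Dominated.of_rep _ had𝒟) (Dominated.counit h𝒟)).of_ker_le fun u hu => by
      have h1 : lift F (LieAlgebra.ad F L) u = 0 := congrArg Prod.fst hu
      have h2 : counit u = (0 : F) := congrArg Prod.snd hu
      simp [g, h1, h2]
  have hformd : ∀ l : List κ, Dominated 𝒟 (iteratedForm g l) := by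
    intro l
    induction l with
    | nil => exact Dominated.counit h𝒟
    | cons i l ih => exact ih.comp_contract h𝒟 (hgd i)
  have hfin : {m : Multiset κ | ∀ i, m.count i < p}.Finite := by
    refine (Set.finite_Iic (p • (Finset.univ : Finset κ).val)).subset fun m hm => ?_
    refine Multiset.le_iff_count.2 fun i => ?_
    rw [Multiset.count_nsmul, Multiset.count_univ, mul_one]
    exact (hm i).le
  obtain ⟨Y, _, _, ρ, hρ, hY⟩ := Dominated.exists_rep h𝒟 _ hfin
    (fun m => iteratedForm g m.toList) fun m _ => hformd m.toList
  refine ⟨Y, _, _, ρ, hρ.1, fun u hu => ?_⟩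
  -- replace `u` by a combination of restricted words that acts in the same way through `σ` and `ρ`
  let τ : L →ₗ⁅F⁆ A × Module.End F Y :=
    { toFun := fun x => (σ x, ρ x)
      map_add' := fun x y => by simp
      map_smul' := fun c x => by simp
      map_lie' := fun {x y} => by
        rw [LieHom.map_lie, LieHom.map_lie]; rfl }
  have hτ : IsCentralRestricted p pow τ :=
    ⟨fun x => Prod.ext (hσ.map_pow x) (hρ.2.map_pow x),
      fun z hz => Prod.ext (hσ.map_center z hz) (hρ.2.map_center z hz)⟩
  have hτl : ∀ w, lift F τ w = (lift F σ w, lift F ρ w) := by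
    have h : lift F τ = (lift F σ).prod (lift F ρ) := by
      ext x : 2
      simp only [LieHom.comp_apply, AlgHom.coe_toLieHom, lift_ι_apply, AlgHom.prod_apply]
      rfl
    intro w
    rw [h]
    rfl
  obtain ⟨v, hv, hvu⟩ := exists_restricted (e := e) (lift F τ) (p := p)
    (Fact.out : p.Prime).two_le (fun x => by
      simp only [lift_ι_apply]; exact hspan τ hτ x)
    (fun x => ⟨pow x, by simp only [lift_ι_apply]; exact hτ.map_pow x⟩) u
  rw [hτl, hτl, Prod.mk.injEq, hu] at hvu
  have hv0 : v = 0 := eq_zero_of_iteratedForm (e := e) g hg1 hg v hv fun m hm =>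
    hY m hm v hvu.2
  rw [AlgHom.toLinearMap_apply, ← hvu.1, hv0, map_zero]

/-! ### Characters of representations over an extension field -/

section RestrictEnd

variable {F K L N : Type*} [Field F] [Field K] [Algebra F K] [LieRing L] [LieAlgebra F L]
  [AddCommGroup N] [Module F N] [Module K N] [IsScalarTower F K N]

/-- A representation by `K`-linear maps, regarded as one by `F`-linear maps. -/
def restrictEnd (ν : L →ₗ⁅F⁆ Module.End K N) : L →ₗ⁅F⁆ Module.End F N where
  toFun x := (ν x).restrictScalars F
  map_add' x y := by ext; simp
  map_smul' c x := by ext; simp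
  map_lie' {x y} := by ext; simp [Ring.lie_def]

/-- A representation by `K`-linear maps has character `c` if `ν(x)^p - ν(x^{[p]})` is the scalar
`c(x)^p` for every `x`. -/
def RepHasCharacter (p : ℕ) (pow : L → L) (ν : L →ₗ⁅F⁆ Module.End K N) (c : L → K) : Prop :=
  ∀ x n, (ν x ^ p) n - ν (pow x) n = c x ^ p • n

end RestrictEnd

namespace Dominated

open UniversalEnvelopingAlgebra

variable {F : Type u} [Field F] {L : Type u} [LieRing L] [LieAlgebra F L] {𝒞 : RepClass F L}
  {X Z : Type*} [AddCommGroup X] [Module F X] [AddCommGroup Z] [Module F Z]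
  {ρ : L →ₗ⁅F⁆ Module.End F X} {σ : L →ₗ⁅F⁆ Module.End F Z}

theorem of_surjective (hρ : Dominated 𝒞 (lift F ρ).toLinearMap) (f : X →ₗ[F] Z)
    (hf : Function.Surjective f) (h : ∀ x v, f (ρ x v) = σ x (f v)) :
    Dominated 𝒞 (lift F σ).toLinearMap := by
  refine hρ.of_ker_le fun u hu => LinearMap.ext fun z => ?_
  obtain ⟨v, rfl⟩ := hf z
  have h1 := lift_equivariant ρ σ f h u v
  rw [show lift F ρ u = 0 from hu, LinearMap.zero_apply, map_zero] at h1
  exact h1.symm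

theorem tensorRep (h𝒞 : IsTensorClass 𝒞) (hρ : Dominated 𝒞 (lift F ρ).toLinearMap)
    (hσ : Dominated 𝒞 (lift F σ).toLinearMap) :
    Dominated 𝒞 (lift F (tensorRep ρ σ)).toLinearMap := by
  refine (tensor h𝒞 hρ hσ).of_ker_le fun u hu => ?_
  rw [AlgHom.toLinearMap_apply, lift_tensorRep]
  rw [LinearMap.comp_apply, AlgHom.toLinearMap_apply] at hu
  rw [hu, map_zero]

theorem zeroRep (h𝒞 : IsTensorClass 𝒞) :
    Dominated 𝒞 (lift F (0 : L →ₗ⁅F⁆ Module.End F Z)).toLinearMap := by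
  refine (Dominated.counit h𝒞).of_ker_le fun u hu => ?_
  have h : lift F (0 : L →ₗ⁅F⁆ Module.End F Z) =
      (Algebra.ofId F (Module.End F Z)).comp UniversalEnvelopingAlgebra.counit := by
    ext x : 2
    simp only [LieHom.comp_apply, AlgHom.coe_toLieHom, AlgHom.comp_apply, lift_ι_apply, counit_ι,
      map_zero]
    rfl
  rw [AlgHom.toLinearMap_apply] at hu ⊢
  rw [h, AlgHom.comp_apply, hu, map_zero]

end Dominated

/-- The linear maps `c : L → K` that are characters of a nonzero finite-dimensional representation
over `K` annihilated by the annihilator of a member of the class `𝒞`. -/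
def CharacterDominated {F : Type u} [Field F] {L : Type u} [LieRing L] [LieAlgebra F L]
    (𝒞 : RepClass F L) {K : Type u} [Field K] [Algebra F K] (p : ℕ) (pow : L → L)
    (c : L →ₗ[F] K) : Prop :=
  ∃ (N : Type u) (_ : AddCommGroup N) (_ : Module F N) (_ : Module K N)
    (_ : IsScalarTower F K N) (ν : L →ₗ⁅F⁆ Module.End K N), FiniteDimensional K N ∧
    Nontrivial N ∧ RepHasCharacter p pow ν c ∧
    Dominated 𝒞 (UniversalEnvelopingAlgebra.lift F (restrictEnd ν)).toLinearMap

section Characters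

variable {F : Type u} [Field F] {L : Type u} [LieRing L] [LieAlgebra F L]
    {𝒞 : RepClass F L} {K : Type u} [Field K] [Algebra F K] {p : ℕ} [Fact p.Prime] [CharP F p]
    {pow : L → L}

omit [CharP F p] in
theorem CharacterDominated.zero (h𝒞 : IsTensorClass 𝒞) :
    CharacterDominated 𝒞 p pow (0 : L →ₗ[F] K) := by
  refine ⟨K, inferInstance, inferInstance, inferInstance, inferInstance, 0, inferInstance,
    inferInstance, fun x n => ?_, Dominated.zeroRep h𝒞⟩
  have hp : p ≠ 0 := (Fact.out : p.Prime).ne_zero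
  simp [zero_pow hp]

theorem CharacterDominated.add (h𝒞 : IsTensorClass 𝒞) {c d : L →ₗ[F] K}
    (hc : CharacterDominated 𝒞 p pow c) (hd : CharacterDominated 𝒞 p pow d) :
    CharacterDominated 𝒞 p pow (c + d) := by
  obtain ⟨N, _, _, _, _, ν, _, _, hν, hνd⟩ := hc
  obtain ⟨M, _, _, _, _, μ, _, _, hμ, hμd⟩ := hd
  let τ : L →ₗ⁅F⁆ Module.End K (N ⊗[K] M) :=
    { toFun := fun x => (ν x).rTensor M + (μ x).lTensor N
      map_add' := fun x y => by
        refine TensorProduct.ext' fun n m => ?_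
        simp; abel
      map_smul' := fun a x => by
        refine TensorProduct.ext' fun n m => ?_
        simp [TensorProduct.smul_tmul']
      map_lie' := fun {x y} => by
        refine TensorProduct.ext' fun n m => ?_
        simp [Ring.lie_def]; abel }
  refine ⟨N ⊗[K] M, inferInstance, inferInstance, inferInstance, inferInstance, τ, inferInstance,
    inferInstance, fun x t => ?_, ?_⟩
  · have hK : CharP K p := charP_of_injective_algebraMap (algebraMap F K).injective p
    have h1 : τ x ^ p = (ν x ^ p).rTensor M + (μ x ^ p).lTensor N := by
      change ((ν x).rTensor M + (μ x).lTensor N) ^ p = _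
      rw [Commute.add_pow_prime_of_algebra K p, LinearMap.rTensor_pow, LinearMap.lTensor_pow]
      exact (LinearMap.rTensor_comp_lTensor (M := N) (N := M) (ν x) (μ x)).trans
        (LinearMap.lTensor_comp_rTensor (M := N) (N := M) (ν x) (μ x)).symm
    have h2 : τ (pow x) = (ν (pow x)).rTensor M + (μ (pow x)).lTensor N := rfl
    rw [h1, h2]
    induction t with
    | zero => simp
    | add a b ha hb => rw [map_add, map_add, smul_add, ← ha, ← hb]; abel
    | tmul n m =>
      have h3 := hν x n
      have h4 := hμ x m
      simp only [LinearMap.add_apply, LinearMap.rTensor_tmul, LinearMap.lTensor_tmul]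
      rw [sub_eq_iff_eq_add] at h3 h4
      rw [h3, h4, add_pow_expChar, TensorProduct.add_tmul, TensorProduct.tmul_add, add_smul,
        TensorProduct.tmul_smul, ← TensorProduct.smul_tmul']
      abel
  · refine Dominated.of_surjective (Dominated.tensorRep h𝒞 hνd hμd)
      (TensorProduct.lift (LinearMap.mk₂ F (fun n m => n ⊗ₜ[K] m)
        (fun _ _ _ => TensorProduct.add_tmul _ _ _)
        (fun _ _ _ => (TensorProduct.smul_tmul' _ _ _).symm)
        (fun _ _ _ => TensorProduct.tmul_add _ _ _) (fun _ _ _ => TensorProduct.tmul_smul _ _ _)))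
        ?_ ?_
    · intro t
      induction t with
      | zero => exact ⟨0, map_zero _⟩
      | add a b ha hb =>
        obtain ⟨a, rfl⟩ := ha
        obtain ⟨b, rfl⟩ := hb
        exact ⟨a + b, map_add _ _ _⟩
      | tmul n m => exact ⟨n ⊗ₜ m, rfl⟩
    · intro x t
      induction t with
      | zero => simp
      | add a b ha hb => rw [map_add, map_add, map_add, map_add, ha, hb]
      | tmul n m => rfl

theorem CharacterDominated.of_mem_primeFieldSpan (h𝒞 : IsTensorClass 𝒞) {X : Set (L →ₗ[F] K)}
    (hX : ∀ c ∈ X, CharacterDominated 𝒞 p pow c) {c : L →ₗ[F] K}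
    (hc : c ∈ primeFieldSpan F p X) : CharacterDominated 𝒞 p pow c := by
  obtain ⟨a, ha, rfl⟩ := hc
  have : NeZero p := ⟨(Fact.out : p.Prime).ne_zero⟩
  refine Finset.sum_induction _ (CharacterDominated 𝒞 p pow) (fun _ _ h h' => h.add h𝒞 h')
    (CharacterDominated.zero h𝒞) fun d hd => ?_
  have h1 : ((a d).cast : F) • d = (a d).val • d := by
    rw [← Nat.cast_smul_eq_nsmul F, ZMod.natCast_val]
  change CharacterDominated 𝒞 p pow (((a d).cast : F) • d)
  rw [h1]
  induction (a d).val with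
  | zero => rw [zero_smul]; exact CharacterDominated.zero h𝒞
  | succ n ih => rw [succ_nsmul]; exact ih.add h𝒞 (hX d (ha hd))

/-- The representation of `L` on the `K`-linear maps between two `K`-linear representations. -/
def homRep {N M : Type*} [AddCommGroup N] [Module F N] [Module K N] [IsScalarTower F K N]
    [AddCommGroup M] [Module F M] [Module K M] [IsScalarTower F K M]
    (ν : L →ₗ⁅F⁆ Module.End K N) (μ : L →ₗ⁅F⁆ Module.End K M) :
    L →ₗ⁅F⁆ Module.End K (N →ₗ[K] M) where
  toFun x := LinearMap.llcomp K N M M (μ x) - LinearMap.lcomp K M (ν x)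
  map_add' x y := by ext; simp; abel
  map_smul' a x := by ext; simp [smul_sub]
  map_lie' {x y} := by ext; simp [Ring.lie_def]; abel

theorem homRep_apply {N M : Type*} [AddCommGroup N] [Module F N] [Module K N]
    [IsScalarTower F K N] [AddCommGroup M] [Module F M] [Module K M] [IsScalarTower F K M]
    (ν : L →ₗ⁅F⁆ Module.End K N) (μ : L →ₗ⁅F⁆ Module.End K M) (x : L) (φ : N →ₗ[K] M) (n : N) :
    homRep ν μ x φ n = μ x (φ n) - φ (ν x n) := rfl

/-- If `N` and `M` have the same character, then `Hom(N, M)` has character zero. -/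
theorem homRep_pow {N M : Type*} [AddCommGroup N] [Module F N] [Module K N]
    [IsScalarTower F K N] [AddCommGroup M] [Module F M] [Module K M] [IsScalarTower F K M]
    {ν : L →ₗ⁅F⁆ Module.End K N} {μ : L →ₗ⁅F⁆ Module.End K M} {c : L →ₗ[F] K}
    (hν : RepHasCharacter p pow ν c) (hμ : RepHasCharacter p pow μ c) (x : L) :
    homRep ν μ x ^ p = homRep ν μ (pow x) := by
  have hK : CharP K p := charP_of_injective_algebraMap (algebraMap F K).injective p
  have h1 : ∀ k : ℕ, (LinearMap.llcomp K N M M (μ x) : Module.End K (N →ₗ[K] M)) ^ k =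
      LinearMap.llcomp K N M M (μ x ^ k) := by
    intro k
    induction k with
    | zero => ext; simp
    | succ k ih => rw [pow_succ, ih, pow_succ]; ext; simp
  have h2 : ∀ k : ℕ, (LinearMap.lcomp K M (ν x) : Module.End K (N →ₗ[K] M)) ^ k =
      LinearMap.lcomp K M (ν x ^ k) := by
    intro k
    induction k with
    | zero => ext; simp
    | succ k ih => rw [pow_succ', ih, pow_succ]; ext; simp
  have h3 : Commute (LinearMap.llcomp K N M M (μ x) : Module.End K (N →ₗ[K] M))
      (LinearMap.lcomp K M (ν x)) := by
    ext; simp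
  change (LinearMap.llcomp K N M M (μ x) - LinearMap.lcomp K M (ν x) :
    Module.End K (N →ₗ[K] M)) ^ p = _
  rw [Commute.sub_pow_prime_of_algebra K p h3, h1, h2]
  ext φ n
  have h4 := hν x n
  have h5 := hμ x (φ n)
  rw [sub_eq_iff_eq_add] at h4 h5
  rw [homRep_apply, LinearMap.sub_apply, LinearMap.sub_apply, LinearMap.llcomp_apply,
    LinearMap.lcomp_apply, h4, h5, map_add, map_smul]
  abel

/-- Let `M` be irreducible with the same character as `N`. A minimal invariant subspace `E` of
`Hom(N, M)` has character zero, so central elements act nilpotently and hence trivially on it;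
and `M` is an image of `E ⊗ N`. -/
theorem dominated_of_irreducible [FiniteDimensional F L] (h𝒞 : IsTensorClass 𝒞)
    (hpow : IsPOperation F p pow) (hcenter : ∀ z ∈ LieAlgebra.center F L, pow z = 0)
    (had : 𝒞 L (LieAlgebra.ad F L)) {c : L →ₗ[F] K} (hc : CharacterDominated 𝒞 p pow c)
    {M : Type u} [AddCommGroup M] [Module F M] [Module K M] [IsScalarTower F K M]
    [FiniteDimensional K M] [Nontrivial M] (μ : L →ₗ⁅F⁆ Module.End K M)
    (hμ : RepHasCharacter p pow μ c)
    (hirr : ∀ P : Submodule K M, (∀ x, ∀ m ∈ P, μ x m ∈ P) → P = ⊥ ∨ P = ⊤) :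
    Dominated 𝒞 (UniversalEnvelopingAlgebra.lift F (restrictEnd μ)).toLinearMap := by
  obtain ⟨N, _, _, _, _, ν, _, _, hν, hνd⟩ := hc
  have hnt : Nontrivial (N →ₗ[K] M) := by
    obtain ⟨n, hn⟩ := exists_ne (0 : N)
    obtain ⟨m, hm⟩ := exists_ne (0 : M)
    obtain ⟨f, hf⟩ := not_forall.1 (mt (Module.forall_dual_apply_eq_zero_iff K n).1 hn)
    refine ⟨⟨f.smulRight m, 0, fun h => ?_⟩⟩
    exact smul_ne_zero hf hm (LinearMap.congr_fun h n)
  obtain ⟨E, ⟨hE0, hE⟩, hmin⟩ := (wellFounded_lt (α := Submodule K (N →ₗ[K] M))).has_min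
    {E | E ≠ ⊥ ∧ ∀ x, ∀ φ ∈ E, homRep ν μ x φ ∈ E} ⟨⊤, top_ne_bot, fun _ _ _ => trivial⟩
  have hcen : ∀ z ∈ LieAlgebra.center F L, ∀ φ ∈ E, homRep ν μ z φ = 0 := by
    intro z hz
    let E' : Submodule K (N →ₗ[K] M) := E ⊓ LinearMap.ker (homRep ν μ z)
    have hE' : ∀ x, ∀ φ ∈ E', homRep ν μ x φ ∈ E' := by
      rintro x φ ⟨hφ, hφz⟩
      refine ⟨hE x φ hφ, ?_⟩
      have h1 : homRep ν μ ⁅x, z⁆ φ = 0 := by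
        rw [(LieModule.mem_maxTrivSubmodule F L L z).1 hz x, map_zero, LinearMap.zero_apply]
      rw [LieHom.map_lie, Ring.lie_def, LinearMap.sub_apply, Module.End.mul_apply,
        Module.End.mul_apply, show homRep ν μ z φ = 0 from hφz, map_zero, zero_sub,
        neg_eq_zero] at h1
      exact h1
    by_cases h0 : E' = ⊥
    · exfalso
      obtain ⟨φ, hφ, hφ0⟩ := E.ne_bot_iff.1 hE0
      have h1 : ∀ k : ℕ, (homRep ν μ z ^ k) φ ∈ E ∧ (homRep ν μ z ^ k) φ ≠ 0 := by
        intro k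
        induction k with
        | zero => exact ⟨hφ, hφ0⟩
        | succ k ih =>
          rw [pow_succ', Module.End.mul_apply]
          refine ⟨hE z _ ih.1, fun h => ih.2 ?_⟩
          have h2 : (homRep ν μ z ^ k) φ ∈ E' := ⟨ih.1, h⟩
          rwa [h0, Submodule.mem_bot] at h2
      refine (h1 p).2 ?_
      rw [homRep_pow hν hμ, hcenter z hz, map_zero, LinearMap.zero_apply]
    · have h1 : E' = E := by
        by_contra hne
        exact hmin E' ⟨h0, hE'⟩ (lt_of_le_of_ne inf_le_left hne)
      intro φ hφ
      rw [← h1] at hφ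
      exact hφ.2
  let σ : L →ₗ⁅F⁆ Module.End F (E.restrictScalars F) :=
    subRep (restrictEnd (homRep ν μ)) (E.restrictScalars F) hE
  have hσ : IsCentralRestricted p pow σ := by
    constructor
    · intro x
      have h1 : ∀ (k : ℕ) (φ : E.restrictScalars F),
          ((σ x ^ k) φ : N →ₗ[K] M) = (homRep ν μ x ^ k) φ := by
        intro k
        induction k with
        | zero => exact fun _ => rfl
        | succ k ih =>
          intro φ
          rw [pow_succ, pow_succ, Module.End.mul_apply, Module.End.mul_apply, ih]
          rfl
      refine LinearMap.ext fun φ => Subtype.ext ?_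
      rw [h1, homRep_pow hν hμ]
      rfl
    · exact fun z hz => LinearMap.ext fun φ => Subtype.ext (hcen z hz φ φ.2)
  have hσd := dominated_of_isCentralRestricted h𝒞 hpow had σ hσ
  let ev : (E.restrictScalars F) ⊗[F] N →ₗ[F] M :=
    TensorProduct.lift (LinearMap.mk₂ F
      (fun (φ : E.restrictScalars F) (n : N) => (φ : N →ₗ[K] M) n)
      (fun _ _ _ => rfl) (fun _ _ _ => rfl) (fun φ _ _ => map_add (φ : N →ₗ[K] M) _ _)
      (fun a φ n => LinearMap.map_smul_of_tower (φ : N →ₗ[K] M) a n))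
  have hev : ∀ x t, ev (tensorRep σ (restrictEnd ν) x t) = restrictEnd μ x (ev t) := by
    intro x t
    induction t with
    | zero => simp
    | add a b ha hb => rw [map_add, map_add, map_add, map_add, ha, hb]
    | tmul φ n =>
      rw [tensorRep_tmul, map_add]
      change (μ x ((φ : N →ₗ[K] M) n) - (φ : N →ₗ[K] M) (ν x n)) + (φ : N →ₗ[K] M) (ν x n) =
        μ x ((φ : N →ₗ[K] M) n)
      rw [sub_add_cancel]
  let P : Submodule K M :=
    { carrier := Set.range ev
      zero_mem' := ⟨0, map_zero _⟩
      add_mem' := by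
        rintro _ _ ⟨a, rfl⟩ ⟨b, rfl⟩
        exact ⟨a + b, map_add _ _ _⟩
      smul_mem' := by
        rintro k _ ⟨t, rfl⟩
        induction t with
        | zero => exact ⟨0, by simp⟩
        | add a b ha hb =>
          obtain ⟨a', ha'⟩ := ha
          obtain ⟨b', hb'⟩ := hb
          exact ⟨a' + b', by rw [map_add, map_add, smul_add, ha', hb']⟩
        | tmul φ n => exact ⟨⟨k • (φ : N →ₗ[K] M), E.smul_mem k φ.2⟩ ⊗ₜ n, rfl⟩ }
  have hP : P = ⊤ := by
    refine (hirr P ?_).resolve_left fun h => ?_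
    · rintro x _ ⟨t, rfl⟩
      exact ⟨_, hev x t⟩
    · obtain ⟨φ, hφ, hφ0⟩ := E.ne_bot_iff.1 hE0
      refine hφ0 (LinearMap.ext fun n => ?_)
      have h1 : φ n ∈ P := ⟨(⟨φ, hφ⟩ : E.restrictScalars F) ⊗ₜ n, rfl⟩
      rw [h] at h1
      exact (Submodule.mem_bot K).1 h1
  refine Dominated.of_surjective (Dominated.tensorRep h𝒞 hσd hνd) ev (fun m => ?_) hev
  have : m ∈ P := by rw [hP]; trivial
  exact this

end Characters

/-! ### Jacobson's formula -/

open Polynomial in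
/-- The derivative of the `n`-th power of a noncommutative polynomial with derivative `a`. -/
theorem derivative_pow_eq_sum {A : Type*} [Ring A] (q a : A[X]) (hq : derivative q = a) (n : ℕ) :
    derivative (q ^ n) = ∑ i ∈ Finset.range n, q ^ i * a * q ^ (n - 1 - i) := by
  induction n with
  | zero => simp
  | succ n ih =>
    rw [pow_succ, derivative_mul, ih, hq, Finset.sum_range_succ, Finset.sum_mul]
    congr 1
    · refine Finset.sum_congr rfl fun i hi => ?_
      have := Finset.mem_range.1 hi
      rw [mul_assoc, ← pow_succ, show n - 1 - i + 1 = n + 1 - 1 - i by omega]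
    · simp

open Polynomial in
/-- Adding a variable to `l` makes `l - r` monic, hence cancellable. -/
theorem Commute.sub_pow_pred_prime (F : Type*) [Field F] (p : ℕ) [Fact p.Prime] [CharP F p]
    {A : Type*} [Ring A] [Algebra F A] {l r : A} (h : Commute l r) :
    (l - r) ^ (p - 1) = ∑ i ∈ Finset.range p, l ^ i * r ^ (p - 1 - i) := by
  cases subsingleton_or_nontrivial A
  · exact Subsingleton.elim _ _
  have hp : 0 < p := (Fact.out : p.Prime).pos
  have hcomm : Commute (X + C l) (C r) :=
    (commute_X (C r)).add_left (h.map C)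
  have hmonic : (X + C l - C r).Monic := by
    rw [add_sub_assoc, ← C_sub]
    exact monic_X_add_C _
  have key : (X + C l - C r) ^ (p - 1) =
      ∑ i ∈ Finset.range p, (X + C l) ^ i * C r ^ (p - 1 - i) := by
    rw [← sub_eq_zero, ← hmonic.mul_left_eq_zero_iff, sub_mul, ← pow_succ,
      Nat.sub_add_cancel hp, hcomm.sub_pow_prime_of_algebra F p, hcomm.geom_sum₂_mul, sub_self]
  have h0 := congrArg constantCoeff key
  simp only [map_pow, map_sub, map_add, map_sum, map_mul] at h0
  simpa using h0

/-- With `l` and `r` the commuting operators of left and right multiplication by `a`, both sides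
are `(l^p - r^p) / (l - r)`. -/
theorem sum_pow_mul_pow_eq_ad_pow (F : Type*) [Field F] (p : ℕ) [Fact p.Prime] [CharP F p]
    {A : Type*} [Ring A] [Algebra F A] (a x : A) :
    ∑ i ∈ Finset.range p, a ^ i * x * a ^ (p - 1 - i) =
      ((LieAlgebra.ad F A a) ^ (p - 1)) x := by
  have h1 : LieAlgebra.ad F A a = LinearMap.mulLeft F a - LinearMap.mulRight F a := by
    ext y
    simp [Ring.lie_def]
  rw [h1, Commute.sub_pow_pred_prime F p (LinearMap.commute_mulLeft_right a a),
    LinearMap.sum_apply]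
  refine Finset.sum_congr rfl fun i _ => ?_
  rw [Module.End.mul_apply, LinearMap.pow_mulLeft, LinearMap.pow_mulRight,
    LinearMap.mulLeft_apply, LinearMap.mulRight_apply, mul_assoc]

open Polynomial in
theorem coeff_ad_pow {F A : Type*} [Field F] [Ring A] [Algebra F A] (x y : A) (n k : ℕ) :
    (((LieAlgebra.ad F A[X] (C x * X + C y)) ^ n) (C x)).coeff k = jacobsonCoeff x y n k := by
  induction n generalizing k with
  | zero =>
    cases k with
    | zero => simp [jacobsonCoeff]
    | succ k => simp [jacobsonCoeff]
  | succ n ih =>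
    rw [pow_succ', Module.End.mul_apply, LieAlgebra.ad_apply, Ring.lie_def]
    set q := ((LieAlgebra.ad F A[X] (C x * X + C y)) ^ n) (C x)
    have h1 : (C x * X + C y) * q - q * (C x * X + C y) =
        (C x * q - q * C x) * X + (C y * q - q * C y) := by
      rw [add_mul, mul_add, sub_mul, mul_assoc, (commute_X q).eq, ← mul_assoc, ← mul_assoc]
      abel
    rw [h1, coeff_add]
    cases k with
    | zero => simp [jacobsonCoeff, ih, Ring.lie_def]
    | succ k => simp [jacobsonCoeff, ih, Ring.lie_def]

open Polynomial in
/-- Jacobson's formula, by comparing coefficients in the derivative of `(T x + y)^p`. -/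
theorem add_pow_eq_jacobson (F : Type*) [Field F] (p : ℕ) [Fact p.Prime] [CharP F p]
    {A : Type*} [Ring A] [Algebra F A] (x y : A) :
    (x + y) ^ p = x ^ p + y ^ p +
      ∑ i ∈ Finset.range (p - 1), ((i + 1 : ℕ) : F)⁻¹ • jacobsonCoeff x y (p - 1) i := by
  cases subsingleton_or_nontrivial A
  · exact Subsingleton.elim _ _
  have hp : 0 < p := (Fact.out : p.Prime).pos
  let q : A[X] := C x * X + C y
  have hdeg : q.natDegree ≤ 1 := natDegree_linear_le
  have hcoeff : ∀ i ∈ Finset.range (p - 1),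
      (q ^ p).coeff (i + 1) = ((i + 1 : ℕ) : F)⁻¹ • jacobsonCoeff x y (p - 1) i := by
    intro i hi
    have hi' := Finset.mem_range.1 hi
    have h1 : (derivative (q ^ p)).coeff i = jacobsonCoeff x y (p - 1) i := by
      rw [derivative_pow_eq_sum q (C x) (by simp [q]), sum_pow_mul_pow_eq_ad_pow F p, coeff_ad_pow]
    have h2 : ((i + 1 : ℕ) : F) ≠ 0 := by
      rw [Ne, CharP.cast_eq_zero_iff F p]
      exact Nat.not_dvd_of_pos_of_lt (Nat.succ_pos i) (by omega)
    rw [← h1, coeff_derivative, eq_inv_smul_iff₀ h2, Nat.cast_smul_eq_nsmul, nsmul_eq_mul']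
    push_cast
    rfl
  have h0 : (q ^ p).coeff 0 = y ^ p := by
    have := map_pow constantCoeff q p
    simpa [q] using this
  have htop : (q ^ p).coeff p = x ^ p := by
    have := coeff_pow_of_natDegree_le hdeg (m := p)
    simpa [q] using this
  have hdegp : (q ^ p).natDegree < p + 1 :=
    Nat.lt_succ_of_le (natDegree_pow_le_of_le p hdeg |>.trans (by simp))
  have hev : (x + y) ^ p = ∑ i ∈ Finset.range (p + 1), (q ^ p).coeff i := by
    have h1 : eval₂RingHom' (RingHom.id A) 1 (fun a => Commute.one_right a) q = x + y := by
      simp [q]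
    have h2 : ∀ f : A[X], eval₂RingHom' (RingHom.id A) 1 (fun a => Commute.one_right a) f =
        f.eval 1 := fun f => rfl
    rw [← h1, ← map_pow, h2, eval_eq_sum_range' hdegp]
    simp
  rw [hev, Finset.sum_range_succ, htop, ← Nat.sub_add_cancel hp, Finset.sum_range_succ',
    Nat.sub_add_cancel hp, h0, Finset.sum_congr rfl hcoeff]
  abel

theorem LieHom.map_jacobsonCoeff {F L A : Type*} [CommRing F] [LieRing L] [LieAlgebra F L]
    [LieRing A] [LieAlgebra F A] (f : L →ₗ⁅F⁆ A) (x y : L) (n k : ℕ) :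
    f (jacobsonCoeff x y n k) = jacobsonCoeff (f x) (f y) n k := by
  induction n generalizing k with
  | zero => cases k <;> simp [jacobsonCoeff]
  | succ n ih => cases k <;> simp [jacobsonCoeff, ih]

/-! ### Existence of characters -/

section Schur

variable {F : Type*} [Field F] {L : Type*} [LieRing L] [LieAlgebra F L] {K : Type*} [Field K]
  [Algebra F K] {p : ℕ} [Fact p.Prime] [CharP F p] {pow : L → L}
  {M : Type*} [AddCommGroup M] [Module F M] [Module K M] [IsScalarTower F K M]
  (μ : L →ₗ⁅F⁆ Module.End K M)

theorem commute_pow_sub_pow (hpow : IsPOperation F p pow) (x y : L) :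
    Commute (μ x ^ p - μ (pow x)) (μ y) := by
  have h1 : LieAlgebra.ad F (Module.End K M) (μ x ^ p) =
      LieAlgebra.ad F (Module.End K M) (μ x) ^ p := by
    have had : ∀ a : Module.End K M, LieAlgebra.ad F (Module.End K M) a =
        LinearMap.mulLeft F a - LinearMap.mulRight F a := fun a => by
      ext; simp [Ring.lie_def]
    rw [had, had, (LinearMap.commute_mulLeft_right _ _).sub_pow_prime_of_algebra F p,
      LinearMap.pow_mulLeft, LinearMap.pow_mulRight]
  have h2 : ∀ k : ℕ, (LieAlgebra.ad F (Module.End K M) (μ x) ^ k) (μ y) =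
      μ ((LieAlgebra.ad F L x ^ k) y) := by
    intro k
    induction k with
    | zero => rfl
    | succ k ih =>
      rw [pow_succ', Module.End.mul_apply, ih, pow_succ', Module.End.mul_apply, LieAlgebra.ad_apply,
        LieAlgebra.ad_apply, LieHom.map_lie]
  have h3 : ⁅μ x ^ p, μ y⁆ = ⁅μ (pow x), μ y⁆ := by
    rw [← LieAlgebra.ad_apply (R := F), h1, h2, ← hpow.ad_pow, LieAlgebra.ad_apply, LieHom.map_lie]
  rw [← sub_eq_zero, ← sub_lie, Ring.lie_def, sub_eq_zero] at h3
  exact h3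

/-- Over an algebraically closed field, `μ(x)^p - μ(x^{[p]})` is a scalar by Schur's lemma. By
Jacobson's formula it is `p`-semilinear in `x`, so that its `p`-th root is linear. -/
theorem exists_repHasCharacter [IsAlgClosed K] [FiniteDimensional K M] [Nontrivial M]
    (hpow : IsPOperation F p pow)
    (hirr : ∀ P : Submodule K M, (∀ x, ∀ m ∈ P, μ x m ∈ P) → P = ⊥ ∨ P = ⊤) :
    ∃ c : L →ₗ[F] K, RepHasCharacter p pow μ c := by
  have hp : 0 < p := (Fact.out : p.Prime).pos
  have hK : CharP K p := charP_of_injective_algebraMap (algebraMap F K).injective p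
  have hscalar : ∀ x, ∃ k : K, μ x ^ p - μ (pow x) = algebraMap K _ k := by
    intro x
    obtain ⟨k, hk⟩ := Module.End.exists_eigenvalue (μ x ^ p - μ (pow x))
    have htop := (hirr (Module.End.eigenspace (μ x ^ p - μ (pow x)) k) (fun y m hm => by
      rw [Module.End.mem_eigenspace_iff] at hm ⊢
      have := LinearMap.congr_fun (commute_pow_sub_pow μ hpow x y).eq m
      rw [Module.End.mul_apply, Module.End.mul_apply, hm, map_smul] at this
      exact this)).resolve_left hk
    refine ⟨k, LinearMap.ext fun m => ?_⟩
    have hm : m ∈ Module.End.eigenspace (μ x ^ p - μ (pow x)) k := by rw [htop]; trivial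
    rw [Module.End.mem_eigenspace_iff.1 hm, Module.algebraMap_end_apply]
  choose k hk using hscalar
  choose c hc using fun x => IsAlgClosed.exists_pow_nat_eq (k x) hp
  have hinj : Function.Injective (algebraMap K (Module.End K M)) :=
    FaithfulSMul.algebraMap_injective K (Module.End K M)
  refine ⟨{ toFun := c, map_add' := fun x y => ?_, map_smul' := fun a x => ?_ }, fun x m => ?_⟩
  · refine frobenius_inj K p ?_
    rw [map_add, frobenius_def, frobenius_def, frobenius_def, hc, hc, hc]
    refine hinj ?_
    rw [map_add, ← hk, ← hk, ← hk, map_add, add_pow_eq_jacobson F p, hpow.add_pow, map_add, map_add,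
      map_sum]
    simp only [map_smul, LieHom.map_jacobsonCoeff]
    abel
  · refine frobenius_inj K p ?_
    rw [RingHom.id_apply, frobenius_def, frobenius_def, smul_pow, hc, hc]
    refine hinj ?_
    rw [← hk, Algebra.smul_def, map_mul, ← hk, map_smul, hpow.smul_pow, map_smul, smul_pow,
      ← smul_sub]
    ext m
    rw [Module.End.mul_apply, Module.algebraMap_end_apply, algebraMap_smul]
    rfl
  · change (μ x ^ p) m - μ (pow x) m = c x ^ p • m
    have h1 := LinearMap.congr_fun (hk x) m
    rwa [LinearMap.sub_apply, Module.algebraMap_end_apply, ← hc] at h1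

end Schur

/-! ### Representations whose restriction to a subalgebra has a split extension in the formation -/

/-- The representations of `L` whose restriction to `S` has its split extension in `𝔉`. For
`S ∈ 𝔉` these are the ones whose restriction to `S` is `𝔉`-hypercentral. -/
def splitExtClass {F : Type u} [Field F] (𝔉 : LieAlgClass F) {L : Type u} [LieRing L]
    [LieAlgebra F L] (S : LieSubalgebra F L) : RepClass F L :=
  fun _ _ _ ρ => 𝔉 (SplitExt (ρ.comp S.incl))

namespace IsSaturatedFormation

open UniversalEnvelopingAlgebra

variable {F : Type u} [Field F] {𝔉 : LieAlgClass F} (h𝔉 : IsSaturatedFormation 𝔉)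
  {L : Type u} [LieRing L] [LieAlgebra F L] {S : LieSubalgebra F L}
include h𝔉

theorem isTensorClass_splitExtClass (hS : 𝔉 S) (hS0 : S ≠ ⊥) :
    IsTensorClass (splitExtClass 𝔉 S) where
  finite Y _ _ ρ hρ := by
    have := h𝔉.finite _ hρ
    exact SplitExt.finite_vec (ρ.comp S.incl)
  trivial := by
    have := LieSubalgebra.nontrivial_of_ne_bot hS0
    exact h𝔉.splitExt_trivialRep hS F
  prod _ _ _ _ _ _ ρ σ hρ hσ := h𝔉.splitExt_prodRep (ρ.comp S.incl) (σ.comp S.incl) hS hρ hσ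
  tensor _ _ _ _ _ _ ρ σ hρ hσ := h𝔉.splitExt_tensorRep (ρ.comp S.incl) (σ.comp S.incl) hS hρ hσ

/-- If `q₁, …, qₙ` span `Q` and `y₁, …, yₘ` span `Y`, the module `Uⁿ` over the enveloping algebra
`U` maps onto `Q` by `(uᵢ) ↦ ∑ uᵢ qᵢ` and into `Yⁿᵐ` by `(uᵢ) ↦ (uᵢ yⱼ)`. The kernel of the
second map consists of the `n`-tuples in the annihilator of `Y`, so `Q` is a subquotient
of `Yⁿᵐ`. -/
theorem splitExtClass_of_annihilator_le {Y Q : Type u} [AddCommGroup Y] [Module F Y]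
    [AddCommGroup Q] [Module F Q] [FiniteDimensional F Q] (hS : 𝔉 S)
    (ρ : L →ₗ⁅F⁆ Module.End F Y) (χ : L →ₗ⁅F⁆ Module.End F Q) (hρ : splitExtClass 𝔉 S Y ρ)
    (h : ∀ u, lift F ρ u = 0 → lift F χ u = 0) : splitExtClass 𝔉 S Q χ := by
  have := h𝔉.finite _ hρ
  have := SplitExt.finite_vec (ρ.comp S.incl)
  let y := Module.finBasis F Y
  let q := Module.finBasis F Q
  let lam : S →ₗ⁅F⁆ Module.End F (UniversalEnvelopingAlgebra F L) :=
    ((Algebra.lmul F (UniversalEnvelopingAlgebra F L) : UniversalEnvelopingAlgebra F L →ₗ⁅F⁆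
      Module.End F (UniversalEnvelopingAlgebra F L)).comp (ι F)).comp S.incl
  let Θ : (Fin (Module.finrank F Q) → UniversalEnvelopingAlgebra F L) →ₗ[F]
      (Fin (Module.finrank F Q) → Fin (Module.finrank F Y) → Y) :=
    LinearMap.pi fun i => LinearMap.pi fun j =>
      LinearMap.applyₗ (y j) ∘ₗ (lift F ρ).toLinearMap ∘ₗ LinearMap.proj i
  let ψ : (Fin (Module.finrank F Q) → UniversalEnvelopingAlgebra F L) →ₗ[F] Q :=
    ∑ i, LinearMap.applyₗ (q i) ∘ₗ (lift F χ).toLinearMap ∘ₗ LinearMap.proj i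
  have hψ : ∀ r, ψ r = ∑ i, lift F χ (r i) (q i) := fun r => by simp [ψ]
  refine h𝔉.splitExt_of_subquotient
    (piRep (piRep (ρ.comp S.incl) (Fin (Module.finrank F Y))) (Fin (Module.finrank F Q)))
    (piRep lam (Fin (Module.finrank F Q))) (χ.comp S.incl) Θ ψ ?_ ?_ ?_ ?_
    (h𝔉.splitExt_piRep _ hS (h𝔉.splitExt_piRep _ hS hρ _) _)
  · intro s r
    funext i j
    change lift F ρ (ι F (s : L) * r i) (y j) = ρ s (lift F ρ (r i) (y j))
    rw [map_mul, lift_ι_apply, Module.End.mul_apply]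
  · intro s r
    rw [hψ, hψ]
    change ∑ i, lift F χ (ι F (s : L) * r i) (q i) = χ s (∑ i, lift F χ (r i) (q i))
    rw [map_sum]
    refine Finset.sum_congr rfl fun i _ => ?_
    rw [map_mul, lift_ι_apply, Module.End.mul_apply]
  · intro v
    refine ⟨fun i => algebraMap F _ (q.repr v i), ?_⟩
    rw [hψ]
    simp only [AlgHom.commutes, Module.algebraMap_end_apply]
    exact q.sum_repr v
  · intro r hr
    have h1 : ∀ i, lift F χ (r i) = 0 := fun i => h _ (y.ext fun j => by
      have h2 := congrFun (congrFun (LinearMap.mem_ker.1 hr) i) j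
      exact h2)
    rw [LinearMap.mem_ker, hψ]
    simp [h1]

end IsSaturatedFormation

/-! ### Extension of scalars -/

section ScalarExtension

open UniversalEnvelopingAlgebra

variable {F L : Type*} [Field F] [LieRing L] [LieAlgebra F L] (K : Type*) [Field K] [Algebra F K]

/-- The representation of `L` on a `K ⊗ L`-module. -/
def extensionRep (M : Type*) [AddCommGroup M] [Module F M] [Module K M] [IsScalarTower F K M]
    [LieRingModule (K ⊗[F] L) M] [LieModule K (K ⊗[F] L) M] : L →ₗ⁅F⁆ Module.End K M where
  toFun x := LieModule.toEnd K (K ⊗[F] L) M (1 ⊗ₜ x)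
  map_add' x y := by rw [TensorProduct.tmul_add, map_add]
  map_smul' a x := by
    rw [TensorProduct.tmul_smul, ← algebraMap_smul K a ((1 : K) ⊗ₜ[F] x), map_smul]
    exact LinearMap.ext fun m => algebraMap_smul K a _
  map_lie' {x y} := by
    rw [← LieHom.map_lie, LieAlgebra.ExtendScalars.bracket_tmul, one_mul]

theorem eq_bot_or_eq_top_of_isIrreducible (M : Type*) [AddCommGroup M] [Module F M] [Module K M]
    [IsScalarTower F K M] [LieRingModule (K ⊗[F] L) M] [LieModule K (K ⊗[F] L) M]
    [LieModule.IsIrreducible K (K ⊗[F] L) M] (P : Submodule K M)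
    (hP : ∀ x : L, ∀ m ∈ P, (extensionRep K M : L →ₗ⁅F⁆ Module.End K M) x m ∈ P) :
    P = ⊥ ∨ P = ⊤ := by
  let P' : LieSubmodule K (K ⊗[F] L) M :=
    { P with
      lie_mem := by
        intro t m hm
        induction t with
        | zero => rw [zero_lie]; exact P.zero_mem
        | add a b ha hb => rw [add_lie]; exact P.add_mem ha hb
        | tmul k x =>
          have h : k ⊗ₜ[F] x = k • ((1 : K) ⊗ₜ[F] x) := by
            rw [TensorProduct.smul_tmul', smul_eq_mul, mul_one]
          rw [h, smul_lie]
          exact P.smul_mem k (hP x m hm) }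
  rcases IsSimpleOrder.eq_bot_or_eq_top P' with h | h
  · exact Or.inl (congrArg LieSubmodule.toSubmodule h)
  · exact Or.inr (congrArg LieSubmodule.toSubmodule h)

/-- Morphisms of `K ⊗ L`-modules commute with the action of the enveloping algebra of `L`. -/
theorem LieModuleHom.map_lift_extensionRep {K M M' : Type*} [Field K] [Algebra F K]
    [AddCommGroup M] [Module F M] [Module K M] [IsScalarTower F K M] [LieRingModule (K ⊗[F] L) M]
    [LieModule K (K ⊗[F] L) M] [AddCommGroup M'] [Module F M'] [Module K M'] [IsScalarTower F K M']
    [LieRingModule (K ⊗[F] L) M'] [LieModule K (K ⊗[F] L) M'] (f : M →ₗ⁅K, K ⊗[F] L⁆ M')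
    (u : UniversalEnvelopingAlgebra F L) (m : M) :
    f (lift F (restrictEnd (extensionRep K M)) u m) =
      lift F (restrictEnd (extensionRep K M')) u (f m) :=
  lift_equivariant (restrictEnd (extensionRep K M)) (restrictEnd (extensionRep K M'))
    ((f : M →ₗ[K] M').restrictScalars F) (fun _ _ => f.map_lie _ _) u m

end ScalarExtension

section ClosureFactors

instance LieSubmodule.Quotient.isScalarTower {F K L M : Type*} [CommRing F] [CommRing K]
    [Algebra F K] [LieRing L] [LieAlgebra K L] [AddCommGroup M] [Module F M] [Module K M]
    [IsScalarTower F K M] [LieRingModule L M] [LieModule K L M] (N : LieSubmodule K L M) :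
    IsScalarTower F K (M ⧸ N) :=
  inferInstanceAs (IsScalarTower F K (M ⧸ N.toSubmodule))

open UniversalEnvelopingAlgebra

variable {F : Type u} [Field F] {L : Type u} [LieRing L] [LieAlgebra F L] {𝒞 : RepClass F L}
  {K : Type u} [Field K] [Algebra F K]
  {V : Type u} [AddCommGroup V] [Module F V] [LieRingModule L V] [LieModule F L V]

/-- The annihilator of `V` annihilates all factors of `K ⊗ V`. -/
theorem dominated_moduleFactor (hV : 𝒞 V (LieModule.toEnd F L V))
    (N₁ N₂ : LieSubmodule K (K ⊗[F] L) (K ⊗[F] V)) :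
    Dominated 𝒞 (lift F (restrictEnd (extensionRep K (moduleFactor N₁ N₂)))).toLinearMap := by
  have h1 : Dominated 𝒞 (lift F (restrictEnd (extensionRep K (K ⊗[F] V)))).toLinearMap := by
    refine (Dominated.of_rep _ hV).of_ker_le fun u hu => LinearMap.ext fun t => ?_
    induction t with
    | zero => rw [map_zero, map_zero]
    | add a b ha hb => rw [map_add, map_add, ha, hb]
    | tmul k v =>
      have h2 := lift_equivariant (LieModule.toEnd F L V)
        (restrictEnd (extensionRep K (K ⊗[F] V))) (TensorProduct.mk F K V k)
        (fun x v => by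
          change k ⊗ₜ[F] ⁅x, v⁆ = ⁅(1 : K) ⊗ₜ[F] x, k ⊗ₜ[F] v⁆
          rw [LieAlgebra.ExtendScalars.bracket_tmul, one_mul]) u v
      rw [show lift F (LieModule.toEnd F L V) u = 0 from hu, LinearMap.zero_apply, map_zero] at h2
      exact h2.symm
  refine h1.of_ker_le fun u hu => LinearMap.ext fun q => ?_
  obtain ⟨n, rfl⟩ := LieSubmodule.Quotient.surjective_mk' _ q
  have h2 : lift F (restrictEnd (extensionRep K N₂)) u n = 0 := by
    refine N₂.injective_incl ?_
    rw [LieModuleHom.map_lift_extensionRep, map_zero,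
      show lift F (restrictEnd (extensionRep K (K ⊗[F] V))) u = 0 from hu, LinearMap.zero_apply]
  rw [AlgHom.toLinearMap_apply, ← LieModuleHom.map_lift_extensionRep, h2, map_zero,
    LinearMap.zero_apply]

theorem characterDominated_of_mem_characterCluster {p : ℕ} {pow : L → L} [FiniteDimensional F V]
    (hV : 𝒞 V (LieModule.toEnd F L V)) {c : L →ₗ[F] AlgebraicClosure F}
    (hc : c ∈ characterCluster F V p pow) : CharacterDominated 𝒞 p pow c := by
  obtain ⟨N₁, N₂, _, hirr, hchar⟩ := hc
  have hnt : Nontrivial (moduleFactor N₁ N₂) :=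
    (LieSubmodule.nontrivial_iff (AlgebraicClosure F) (AlgebraicClosure F ⊗[F] L) _).1
      inferInstance
  have : FiniteDimensional (AlgebraicClosure F) N₂ :=
    inferInstanceAs (FiniteDimensional (AlgebraicClosure F) N₂.toSubmodule)
  exact ⟨moduleFactor N₁ N₂, inferInstance, inferInstance, inferInstance, inferInstance,
    extensionRep (AlgebraicClosure F) (moduleFactor N₁ N₂),
    Module.Finite.of_surjective (LieSubmodule.Quotient.mk' (N₁.comap N₂.incl) :
      N₂ →ₗ[AlgebraicClosure F] moduleFactor N₁ N₂) (LieSubmodule.Quotient.surjective_mk' _),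
    hnt, hchar, dominated_moduleFactor hV N₁ N₂⟩

theorem lid_rTensor_mem_of_mem_baseChange (V₁ : LieSubmodule F L V) (l : K →ₗ[F] F)
    {t : K ⊗[F] V} (ht : t ∈ V₁.baseChange K) : TensorProduct.lid F V (l.rTensor V t) ∈ V₁ := by
  obtain ⟨s, rfl⟩ := ht
  induction s with
  | zero => simp
  | add a c ha hc => simp only [map_add]; exact V₁.add_mem ha hc
  | tmul k v => simpa using V₁.smul_mem (l k) v.2

/-- Let the factor `N₂ / (K ⊗ V₁)` of `K ⊗ V` be annihilated by the annihilator `J` of `ρ`. With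
respect to an `F`-basis of `K`, the coordinates in `V` of an element of `N₂` are sent into `V₁`
by `J`, and if the element is not in `K ⊗ V₁`, one of its coordinates is not in `V₁`. -/
theorem exists_notMem_of_annihilator {Y : Type u} [AddCommGroup Y] [Module F Y]
    (ρ : L →ₗ⁅F⁆ Module.End F Y) (V₁ : LieSubmodule F L V)
    {N₂ : LieSubmodule K (K ⊗[F] L) (K ⊗[F] V)} (hlt : V₁.baseChange K < N₂)
    (h : ∀ u, lift F ρ u = 0 →
      lift F (restrictEnd (extensionRep K (moduleFactor (V₁.baseChange K) N₂))) u = 0) :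
    ∃ v ∉ V₁, ∀ u, lift F ρ u = 0 → lift F (LieModule.toEnd F L V) u v ∈ V₁ := by
  classical
  obtain ⟨t, ht2, ht1⟩ := SetLike.exists_of_lt hlt
  have hJ : ∀ u, lift F ρ u = 0 →
      lift F (restrictEnd (extensionRep K (K ⊗[F] V))) u t ∈ V₁.baseChange K := by
    intro u hu
    have h1 := (LieSubmodule.Quotient.mk' ((V₁.baseChange K).comap N₂.incl)).map_lift_extensionRep
      u ⟨t, ht2⟩
    have h2 := N₂.incl.map_lift_extensionRep u ⟨t, ht2⟩
    rw [h u hu, LinearMap.zero_apply] at h1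
    have h3 := (LieSubmodule.Quotient.mk_eq_zero (N := (V₁.baseChange K).comap N₂.incl)).1 h1
    exact (congrArg (· ∈ V₁.baseChange K) h2).mp h3
  let b := Module.Basis.ofVectorSpace F K
  let f : Module.Basis.ofVectorSpaceIndex F K → K ⊗[F] V →ₗ[F] V := fun i =>
    TensorProduct.lid F V ∘ₗ (b.coord i).rTensor V
  have hf : ∀ i (x : L) s,
      f i ((restrictEnd (extensionRep K (K ⊗[F] V)) : L →ₗ⁅F⁆ Module.End F _) x s) =
      LieModule.toEnd F L V x (f i s) := by
    intro i x s
    induction s with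
    | zero => simp
    | add a c ha hc => rw [map_add, map_add, map_add, map_add, ha, hc]
    | tmul k v =>
      change f i ⁅((1 : K) ⊗ₜ[F] x : K ⊗[F] L), k ⊗ₜ[F] v⁆ = ⁅x, f i (k ⊗ₜ[F] v)⁆
      rw [LieAlgebra.ExtendScalars.bracket_tmul, one_mul]
      simp [f]
  have ht : ∃ i, f i t ∉ V₁ := by
    by_contra! hall
    apply ht1
    have h1 := (TensorProduct.equivFinsuppOfBasisLeft (N := V) b).symm_apply_apply t
    rw [TensorProduct.equivFinsuppOfBasisLeft_symm_apply] at h1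
    rw [← h1]
    refine sum_mem fun i _ => LieSubmodule.tmul_mem_baseChange_of_mem _ ?_
    rw [TensorProduct.equivFinsuppOfBasisLeft_apply]
    exact hall i
  obtain ⟨i, hi⟩ := ht
  refine ⟨f i t, hi, fun u hu => ?_⟩
  rw [← lift_equivariant _ _ (f i) (hf i)]
  exact lid_rTensor_mem_of_mem_baseChange V₁ _ (hJ u hu)

end ClosureFactors

/-! ### Descent from the algebraic closure -/

namespace IsSaturatedFormation

open UniversalEnvelopingAlgebra

variable {F : Type u} [Field F] {𝔉 : LieAlgClass F} (h𝔉 : IsSaturatedFormation 𝔉)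
  {L : Type u} [LieRing L] [LieAlgebra F L] {S : LieSubalgebra F L}
include h𝔉

/-- If every irreducible factor of `K ⊗ W` is dominated by the class, then `W` belongs to it:
otherwise a maximal submodule `W₁` of `W` in the class is properly contained in the preimage of
the part of `W / W₁` that is killed by the annihilator of a member of the class. -/
theorem splitExtClass_of_forall_factor (K : Type u) [Field K] [Algebra F K] (hS : 𝔉 S)
    {W : Type u} [AddCommGroup W] [Module F W] [FiniteDimensional F W] [LieRingModule L W]
    [LieModule F L W]
    (h : ∀ N₁ N₂ : LieSubmodule K (K ⊗[F] L) (K ⊗[F] W), N₁ ≤ N₂ →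
      LieModule.IsIrreducible K (K ⊗[F] L) (moduleFactor N₁ N₂) →
      Dominated (splitExtClass 𝔉 S)
        (lift F (restrictEnd (extensionRep K (moduleFactor N₁ N₂)))).toLinearMap) :
    splitExtClass 𝔉 S W (LieModule.toEnd F L W) := by
  have := h𝔉.finite S hS
  have hbot : splitExtClass 𝔉 S _ (LieModule.toEnd F L (⊥ : LieSubmodule F L W)) :=
    h𝔉.splitExt_of_subsingleton _ hS
  obtain ⟨W₁, hW₁, hmax⟩ := (wellFounded_gt (α := LieSubmodule F L W)).has_min
    {N | splitExtClass 𝔉 S _ (LieModule.toEnd F L N)} ⟨⊥, hbot⟩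
  by_cases htop : W₁ = ⊤
  · subst htop
    exact h𝔉.splitExt_of_surjective _ _ (⊤ : LieSubmodule F L W).toSubmodule.subtype
      (fun _ _ => rfl) (fun v => ⟨⟨v, LieSubmodule.mem_top v⟩, rfl⟩) hW₁
  have htop' : W₁.baseChange K ≠ ⊤ := by
    intro he
    obtain ⟨l, hl⟩ := not_forall.1
      (mt (Module.forall_dual_apply_eq_zero_iff F (1 : K)).1 one_ne_zero)
    refine htop (eq_top_iff.2 fun w _ => ?_)
    have h1 := lid_rTensor_mem_of_mem_baseChange W₁ l (t := 1 ⊗ₜ w) (he ▸ LieSubmodule.mem_top _)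
    rw [LinearMap.rTensor_tmul, TensorProduct.lid_tmul] at h1
    exact (W₁.toSubmodule.smul_mem_iff hl).1 h1
  have := LieSubmodule.wellFoundedLT_of_isArtinian K (K ⊗[F] L) (K ⊗[F] W)
  obtain ⟨N₂, hN₂⟩ := exists_covBy_of_wellFoundedLT (fun hm => htop' (isMax_iff_eq_top.1 hm))
  obtain ⟨Y, _, _, ρ, hρ, hY⟩ := h _ N₂ hN₂.le (isIrreducible_moduleFactor hN₂)
  obtain ⟨w, hw, hwJ⟩ := exists_notMem_of_annihilator ρ W₁ hN₂.lt hY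
  let W₂ : LieSubmodule F L W :=
    { carrier := {w | ∀ u, lift F ρ u = 0 → lift F (LieModule.toEnd F L W) u w ∈ W₁}
      zero_mem' := fun u _ => by rw [map_zero]; exact W₁.zero_mem
      add_mem' := fun ha hb u hu => by rw [map_add]; exact W₁.add_mem (ha u hu) (hb u hu)
      smul_mem' := fun c a ha u hu => by rw [map_smul]; exact W₁.smul_mem c (ha u hu)
      lie_mem := fun {x a} ha u hu => by
        have h1 := ha (u * ι F x) (by rw [map_mul, hu, zero_mul])
        rwa [map_mul, lift_ι_apply] at h1 }
  have hle : W₁ ≤ W₂ := fun a ha u _ =>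
    lift_mem (LieModule.toEnd F L W) W₁.toSubmodule (fun x v hv => W₁.lie_mem hv) u ha
  refine absurd (lt_of_le_of_ne hle fun he => hw (he.symm ▸ (hwJ : w ∈ W₂))) (hmax W₂ ?_)
  have hQ : splitExtClass 𝔉 S _ (LieModule.toEnd F L (moduleFactor W₁ W₂)) := by
    have : FiniteDimensional F W₂ := inferInstanceAs (FiniteDimensional F W₂.toSubmodule)
    have : FiniteDimensional F (moduleFactor W₁ W₂) := Module.Finite.of_surjective
      (LieSubmodule.Quotient.mk' (W₁.comap W₂.incl) : W₂ →ₗ[F] moduleFactor W₁ W₂)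
      (LieSubmodule.Quotient.surjective_mk' _)
    refine h𝔉.splitExtClass_of_annihilator_le hS ρ _ hρ fun u hu => LinearMap.ext fun v => ?_
    obtain ⟨a, rfl⟩ := LieSubmodule.Quotient.surjective_mk' _ v
    have h1 := lift_equivariant (LieModule.toEnd F L W₂)
      (LieModule.toEnd F L (moduleFactor W₁ W₂)) (LieSubmodule.Quotient.mk' (W₁.comap W₂.incl) :
        W₂ →ₗ[F] moduleFactor W₁ W₂) (fun _ _ => rfl) u a
    have h2 := lift_equivariant (LieModule.toEnd F L W₂) (LieModule.toEnd F L W)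
      (W₂.incl : W₂ →ₗ[F] W) (fun _ _ => rfl) u a
    refine h1.symm.trans ((LieSubmodule.Quotient.mk_eq_zero (N := W₁.comap W₂.incl)).2 ?_)
    exact (congrArg (· ∈ W₁) h2).mpr (a.2 u hu)
  refine h𝔉.splitExt_of_extension ((LieModule.toEnd F L W₁).comp S.incl) _
    ((LieModule.toEnd F L (moduleFactor W₁ W₂)).comp S.incl) (Submodule.inclusion hle)
    (LieSubmodule.Quotient.mk' (W₁.comap W₂.incl) : W₂ →ₗ[F] moduleFactor W₁ W₂)
    (fun _ _ => rfl) (fun _ _ => rfl) (Submodule.inclusion_injective hle)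
    (LieSubmodule.Quotient.surjective_mk' _) ?_ hW₁ hQ
  rw [Submodule.range_inclusion]
  exact Submodule.ker_mkQ _

end IsSaturatedFormation

end

theorem theorem1 {F : Type u} [Field F] (p : ℕ) [Fact p.Prime] [CharP F p]
    (𝔉 : LieAlgClass F) (h𝔉 : IsSaturatedFormation 𝔉)
    (L : Type u) [LieRing L] [LieAlgebra F L] [FiniteDimensional F L]
    (pow : L → L) (hpow : IsPOperation F p pow)
    (hcenter : ∀ z ∈ LieAlgebra.center F L, pow z = 0)
    (S : LieSubalgebra F L) (hS𝔉 : 𝔉 S) (hS0 : S ≠ ⊥) (hSsub : IsSubnormalSubalgebra S)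
    (V W : Type u)
    [AddCommGroup V] [Module F V] [FiniteDimensional F V] [LieRingModule L V] [LieModule F L V]
    [AddCommGroup W] [Module F W] [FiniteDimensional F W] [LieRingModule L W] [LieModule F L W]
    (hcl : characterCluster F W p pow ⊆ primeFieldSpan F p (characterCluster F V p pow))
    (hV : IsFHypercentral 𝔉 S V) :
    IsFHypercentral 𝔉 S W := by
  have h𝒞 := h𝔉.isTensorClass_splitExtClass hS𝔉 hS0
  have hV𝒞 : splitExtClass 𝔉 S V (LieModule.toEnd F L V) :=
    h𝔉.splitExt_of_isFHypercentral hS𝔉 hV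
  have had : splitExtClass 𝔉 S L (LieAlgebra.ad F L) :=
    h𝔉.splitExt_ad_of_subnormal S hS𝔉 hS0 hSsub
  refine h𝔉.isFHypercentral_of_splitExt ?_
  refine h𝔉.splitExtClass_of_forall_factor (AlgebraicClosure F) hS𝔉 fun N₁ N₂ hle hirr => ?_
  have : Nontrivial (moduleFactor N₁ N₂) :=
    (LieSubmodule.nontrivial_iff (AlgebraicClosure F) (AlgebraicClosure F ⊗[F] L) _).1
      inferInstance
  have : FiniteDimensional (AlgebraicClosure F) N₂ :=
    inferInstanceAs (FiniteDimensional (AlgebraicClosure F) N₂.toSubmodule)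
  have : FiniteDimensional (AlgebraicClosure F) (moduleFactor N₁ N₂) :=
    Module.Finite.of_surjective (LieSubmodule.Quotient.mk' (N₁.comap N₂.incl) :
      N₂ →ₗ[AlgebraicClosure F] moduleFactor N₁ N₂) (LieSubmodule.Quotient.surjective_mk' _)
  have hirr' := eq_bot_or_eq_top_of_isIrreducible (F := F) (L := L) (AlgebraicClosure F)
    (moduleFactor N₁ N₂)
  obtain ⟨c, hc⟩ := exists_repHasCharacter
    (extensionRep (AlgebraicClosure F) (moduleFactor N₁ N₂)) hpow hirr'
  have hmem : c ∈ characterCluster F W p pow := ⟨N₁, N₂, hle, hirr, hc⟩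
  exact dominated_of_irreducible h𝒞 hpow hcenter had
    (CharacterDominated.of_mem_primeFieldSpan h𝒞
      (fun _ => characterDominated_of_mem_characterCluster hV𝒞) (hcl hmem)) _ hc hirr'
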